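/- Let $u$ be a unitary $nm\times nm$ matrix, $u=(u_{(i,j),(k,l)})$ with $1\le i,k\le n$, $1\le j,l\le m$, and let $E=\mathbb C^n$, $F=\mathbb C^m$ with orthonormal bases $(e_i)$, $(f_j)$. Identify $E\otimes F$ with $F\otimes E$ by $e_i\otimes f_j=\sum_{k,l}u_{(i,j),(k,l)}\,f_l\otimes e_k$, let $\mathcal F(n,m,u)=\bigoplus_{k,l\ge 0}E^{\otimes k}\otimes F^{\otimes l}$ (Hilbert space direct sum), and let $L_{e_i}$, $L_{f_j}$ be the left creation operators on it (the result of $L_{f_j}$ is rewritten in $E^{\otimes k}\otimes F^{\otimes(l+1)}$ by means of the identification). Let $\mathcal A_u$ be the norm closed unital algebra of operators generated by all $L_{e_i}$ and $L_{f_j}$. Let $\Omega_u$ be the set of all $(z,w)\in\mathbb C^n\times\mathbb C^m$ with $\|z\|\le 1$, $\|w\|\le 1$ (Euclidean norms) and $z_iw_j=\sum_{k,l}u_{(i,j),(k,l)}z_kw_l$ for all $i,j$; the character space of $\mathcal A_u$ is identified with $\Omega_u$ through $\varphi\mapsto\big((\varphi(L_{e_i}))_i,(\varphi(L_{f_j}))_j\big)$.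 Let $v$ be a unitary $n'm'\times n'm'$ matrix, with $\mathcal A_v$ and $\Omega_v$ defined likewise. An algebra isomorphism $\Psi:\mathcal A_u\to\mathcal A_v$ induces the map $\theta_\Psi:\Omega_u\to\Omega_v$ that corresponds to $\varphi\mapsto\varphi\circ\Psi^{-1}$ on characters. **Proposition 5.7.** Let $\Psi:\mathcal A_u\to\mathcal A_v$ be an algebra isomorphism (not assumed continuous) with $\theta_\Psi(0,0)=(0,0)$. Then: 1. $\{n,m\}=\{n',m'\}$. 2. Either $n=n'$, $m=m'$ and there are unitaries $U:\mathbb C^n\to\mathbb C^{n'}$ and $V:\mathbb C^m\to\mathbb C^{m'}$ such that $\theta_\Psi(z,w)=(Uz,Vw)$ for all $(z,w)\in\Omega_u$; or $n=m'$, $m=n'$ and there are unitaries $U:\mathbb C^n\to\mathbb C^{m'}$ and $V:\mathbb C^m\to\mathbb C^{n'}$ such that $\theta_\Psi(z,w)=(Vw,Uz)$ for all $(z,w)\in\Omega_u$. (So if $(n',m')=(n,m)$, the second alternative is possible only when $n=m$.) 3. If $\Psi$ is isometric, then either $\Psi$ is bigraded, that is, $n=n'$, $m=m'$ and there are unitary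 matrices $A=(a_{i,j})$ ($n\times n$) and $B=(b_{k,l})$ ($m\times m$) with $\Psi(L_{e_i})=\sum_j a_{i,j}L_{e_j}$ and $\Psi(L_{f_k})=\sum_l b_{k,l}L_{f_l}$; or $\Psi$ is a graded exchange isomorphism, that is, $n=m'$, $m=n'$, there are unitary matrices $A$ ($n\times n$) and $B$ ($m\times m$) with $\Psi(L_{e_i})=\sum_j a_{i,j}L_{f_j}$ and $\Psi(L_{f_k})=\sum_l b_{k,l}L_{e_l}$, and $\Psi$ is graded: for every $N$ it maps the span of the products $L_{e_{i_1}}\cdots L_{e_{i_k}}L_{f_{j_1}}\cdots L_{f_{j_l}}$ with $k+l=N$ in $\mathcal A_u$ onto the corresponding span in $\mathcal A_v$. -/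

import Mathlib

noncomputable section

open scoped ComplexConjugate

namespace UnitaryRelation

/-- The `nm × nm` unitary matrices, with rows and columns indexed by pairs `(i, j)`. -/
abbrev UMat (n m : ℕ) : Type := Matrix.unitaryGroup (Fin n × Fin m) ℂ

/-- Words `e_α f_β`, `α` a word in `1, …, n` and `β` a word in `1, …, m`. The words with
`|α| = k`, `|β| = l` index the standard orthonormal basis of `E^{⊗ k} ⊗ F^{⊗ l}`, where
`E = ℂⁿ` and `F = ℂᵐ`. -/
abbrev Word (n m : ℕ) : Type := List (Fin n) × List (Fin m)

/-- The Fock space `∑_{k,l} ⊕ E^{⊗ k} ⊗ F^{⊗ l}`, as the space of square summable families of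
coefficients with respect to its standard orthonormal basis. -/
abbrev Fock (n m : ℕ) : Type := lp (fun _ : Word n m => ℂ) 2

variable {n m n' m' : ℕ}

/-- The basis vector `e_α ⊗ f_β`. -/
def basisVec (a : Word n m) : Fock n m := lp.single 2 a (1 : ℂ)

theorem inner_basisVec (a b : Word n m) :
    inner ℂ (basisVec a) (basisVec b) = if a = b then (1 : ℂ) else 0 := by
  unfold basisVec
  rw [lp.inner_single_left]
  by_cases h : a = b
  · subst h; simp
  · simp [h, lp.single_apply]

/-- The bounded operator (an isometry) which maps the standard orthonormal basis to the
orthonormal family `v`. -/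
def isometryOf (v : Word n m → Fock n m) (hv : Orthonormal ℂ v) : Fock n m →L[ℂ] Fock n m :=
  hv.orthogonalFamily.linearIsometry.toContinuousLinearMap

theorem isometryOf_basisVec (v : Word n m → Fock n m) (hv : Orthonormal ℂ v) (a : Word n m) :
    isometryOf v hv (basisVec a) = v a := by
  simp [isometryOf, basisVec]

theorem orthonormal_consE (i : Fin n) :
    Orthonormal ℂ (fun a : Word n m => (basisVec (i :: a.1, a.2) : Fock n m)) := by
  rw [orthonormal_iff_ite]
  rintro ⟨a, b⟩ ⟨a', b'⟩
  simp [inner_basisVec]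

/-- The shift `L_{e_i}`: `e_α ⊗ f_β ↦ e_i ⊗ e_α ⊗ f_β`. -/
def Le (i : Fin n) : Fock n m →L[ℂ] Fock n m :=
  isometryOf (fun a => basisVec (i :: a.1, a.2)) (orthonormal_consE i)

/-- The vector `f_l ⊗ e_α ⊗ f_β`, written as a vector of `E^{⊗ k} ⊗ F^{⊗ (l+1)}` by means of the
identification `f_l ⊗ e_k = ∑_{i,j} conj(u_{(i,j),(k,l)}) e_i ⊗ f_j`, which is applied
successively to move the `F`-factor to the right of all `E`-factors. -/
def fVec (u : UMat n m) : Fin m → List (Fin n) → List (Fin m) → Fock n m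
  | l, [], b => basisVec ([], l :: b)
  | l, k :: a, b =>
      ∑ p : Fin n × Fin m, conj (u.1 p (k, l)) • Le p.1 (fVec u p.2 a b)

theorem inner_isometryOf_eq_zero (v : Word n m → Fock n m) (hv : Orthonormal ℂ v)
    (x y : Fock n m) (h : ∀ a, inner ℂ x (v a) = (0 : ℂ)) :
    inner ℂ x (isometryOf v hv y) = (0 : ℂ) := by
  have h1 := (hv.orthogonalFamily.hasSum_linearIsometry y).mapL (innerSL ℂ x)
  have h2 : ∀ a, innerSL ℂ x (LinearIsometry.toSpanSingleton ℂ (Fock n m) (hv.1 a) (y a)) = 0 := by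
    intro a
    simp [h a]
  simp only [h2] at h1
  exact h1.unique hasSum_zero

theorem inner_basisVec_nil_Le (b : List (Fin m)) (i : Fin n) (y : Fock n m) :
    inner ℂ (basisVec ([], b)) (Le i y) = (0 : ℂ) :=
  inner_isometryOf_eq_zero _ _ _ _ fun a => by simp [inner_basisVec]

theorem inner_Le_Le (i i' : Fin n) (x y : Fock n m) :
    inner ℂ (Le i x) (Le i' y) = if i = i' then inner ℂ x y else (0 : ℂ) := by
  split_ifs with h
  · subst h
    exact (orthonormal_consE (m := m) i).orthogonalFamily.linearIsometry.inner_map_map x y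
  · refine inner_isometryOf_eq_zero _ _ _ _ fun c => ?_
    rw [← inner_conj_symm, map_eq_zero]
    refine inner_isometryOf_eq_zero _ _ _ _ fun a => ?_
    simp [inner_basisVec, Ne.symm h]

theorem inner_fVec (u : UMat n m) (a a' : List (Fin n)) (l l' : Fin m) (b b' : List (Fin m)) :
    inner ℂ (fVec u l a b) (fVec u l' a' b') =
      if l = l' ∧ a = a' ∧ b = b' then (1 : ℂ) else 0 := by
  induction a generalizing a' l l' with
  | nil =>
    cases a' with
    | nil => simp [fVec, inner_basisVec]
    | cons k' a' => simp only [fVec, inner_sum, inner_smul_right, inner_basisVec_nil_Le]; simp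
  | cons k a ih =>
    cases a' with
    | nil =>
      rw [← inner_conj_symm]
      simp [fVec, inner_sum, inner_smul_right, inner_basisVec_nil_Le]
    | cons k' a' =>
      have hu : ∑ p : Fin n × Fin m, u.1 p (k, l) * conj (u.1 p (k', l')) =
          if (k', l') = (k, l) then (1 : ℂ) else 0 := by
        have h := congrFun (congrFun (Matrix.UnitaryGroup.star_mul_self u) (k', l')) (k, l)
        rw [Matrix.mul_apply, Matrix.one_apply] at h
        rw [← h]
        refine Finset.sum_congr rfl fun p _ => ?_
        simp [Matrix.star_apply, mul_comm]
      simp only [fVec, sum_inner, inner_sum, inner_smul_left, inner_smul_right, inner_Le_Le, ih,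
        RCLike.conj_conj]
      have h3 : ∀ p q : Fin n × Fin m,
          (conj (u.1 q (k', l')) * (u.1 p (k, l) * if p.1 = q.1 then
            (if p.2 = q.2 ∧ a = a' ∧ b = b' then (1 : ℂ) else 0) else 0)) =
          if q = p then (u.1 q (k, l) * conj (u.1 q (k', l'))) *
            (if a = a' ∧ b = b' then 1 else 0) else 0 := by
        rintro ⟨p1, p2⟩ ⟨q1, q2⟩
        by_cases h1 : p1 = q1
        · by_cases h2 : p2 = q2
          · subst h1; subst h2; simp only [if_true, true_and]; ring
          · simp [h1, h2, Ne.symm h2]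
        · simp [h1, Ne.symm h1]
      simp_rw [Finset.mul_sum, h3, Finset.sum_ite_eq, Finset.mem_univ, if_true]
      rw [← Finset.sum_mul, hu]
      simp only [Prod.mk.injEq, eq_comm (a := k'), eq_comm (a := l')]
      by_cases h1 : k = k' <;> by_cases h2 : l = l' <;> simp [h1, h2]

theorem orthonormal_fVec (u : UMat n m) (l : Fin m) :
    Orthonormal ℂ (fun a : Word n m => fVec u l a.1 a.2) := by
  rw [orthonormal_iff_ite]
  rintro ⟨a, b⟩ ⟨a', b'⟩
  simp [inner_fVec]

/-- The shift `L_{f_l}`: `e_α ⊗ f_β ↦ f_l ⊗ e_α ⊗ f_β`. -/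
def Lf (u : UMat n m) (l : Fin m) : Fock n m →L[ℂ] Fock n m :=
  isometryOf (fun a => fVec u l a.1 a.2) (orthonormal_fVec u l)

/-- The algebra `𝒜_u`: the norm closure of the unital algebra generated by the operators
`L_{e_i}` and `L_{f_j}`. -/
abbrev Alg (u : UMat n m) : Type :=
  (Algebra.adjoin ℂ (Set.range (Le : Fin n → Fock n m →L[ℂ] Fock n m) ∪
    Set.range (Lf u))).topologicalClosure

/-- The generator `L_{e_i}` as an element of `𝒜_u`. -/
def genE (u : UMat n m) (i : Fin n) : Alg u :=
  ⟨Le i, Subalgebra.le_topologicalClosure _ (Algebra.subset_adjoin (Or.inl ⟨i, rfl⟩))⟩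

/-- The generator `L_{f_j}` as an element of `𝒜_u`. -/
def genF (u : UMat n m) (j : Fin m) : Alg u :=
  ⟨Lf u j, Subalgebra.le_topologicalClosure _ (Algebra.subset_adjoin (Or.inr ⟨j, rfl⟩))⟩

/-- The space `ℂⁿ × ℂᵐ`, each factor with its Euclidean norm. -/
abbrev Pt (n m : ℕ) : Type := EuclideanSpace ℂ (Fin n) × EuclideanSpace ℂ (Fin m)

/-- The variety `V_u`. -/
def variety (u : UMat n m) : Set (Pt n m) :=
  {p | ∀ i j, p.1 i * p.2 j = ∑ q : Fin n × Fin m, u.1 (i, j) q * (p.1 q.1 * p.2 q.2)}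

/-- `Ω_u`, the intersection of `V_u` with the product of the two closed unit balls. -/
def Omega (u : UMat n m) : Set (Pt n m) :=
  variety u ∩ {p | ‖p.1‖ ≤ 1 ∧ ‖p.2‖ ≤ 1}

/-- The point `(z, w)`, `z_i = φ(L_{e_i})` and `w_j = φ(L_{f_j})`, by which a character `φ` (a
nonzero multiplicative linear functional) of `𝒜_u` is identified with an element of `Ω_u`.
(Characters of the Banach algebra `𝒜_u` are automatically continuous.) -/
def charPoint (u : UMat n m) (φ : Alg u →ₐ[ℂ] ℂ) : Pt n m :=
  (WithLp.toLp 2 fun i => φ (genE u i), WithLp.toLp 2 fun j => φ (genF u j))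

theorem charPoint_injective (u : UMat n m) : Function.Injective (charPoint u) := by
  intro φ ψ h
  have hE : ∀ i, φ (genE u i) = ψ (genE u i) := fun i =>
    congrArg (fun p : Pt n m => p.1 i) h
  have hF : ∀ j, φ (genF u j) = ψ (genF u j) := fun j =>
    congrArg (fun p : Pt n m => p.2 j) h
  set S := Algebra.adjoin ℂ (Set.range (Le : Fin n → Fock n m →L[ℂ] Fock n m) ∪
    Set.range (Lf u)) with hS
  have hle : S ≤ S.topologicalClosure := Subalgebra.le_topologicalClosure _
  have : CompleteSpace (Alg u) :=
    (Subalgebra.isClosed_topologicalClosure S).completeSpace_coe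
  have hcφ : Continuous φ := φ.toContinuousLinearMap.continuous
  have hcψ : Continuous ψ := ψ.toContinuousLinearMap.continuous
  have hdense : DenseRange (Set.inclusion hle) := by
    rw [denseRange_inclusion_iff]
    · exact fun x hx => hx
    · exact hle
  have hmem : ∀ x (hx : x ∈ S), φ ⟨x, hle hx⟩ = ψ ⟨x, hle hx⟩ := by
    intro x hx
    induction hx using Algebra.adjoin_induction with
    | mem x hx =>
      rcases hx with ⟨i, rfl⟩ | ⟨j, rfl⟩
      · exact hE i
      · exact hF j
    | algebraMap r => exact (φ.commutes r).trans (ψ.commutes r).symm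
    | add x y hx hy h1 h2 =>
      have e : (⟨x + y, hle (add_mem hx hy)⟩ : Alg u) = ⟨x, hle hx⟩ + ⟨y, hle hy⟩ := rfl
      rw [e, map_add, map_add, h1, h2]
    | mul x y hx hy h1 h2 =>
      have e : (⟨x * y, hle (mul_mem hx hy)⟩ : Alg u) = ⟨x, hle hx⟩ * ⟨y, hle hy⟩ := rfl
      rw [e, map_mul, map_mul, h1, h2]
  have := hdense.equalizer hcφ hcψ (funext fun x => hmem x.1 x.2)
  exact DFunLike.coe_injective this

/-- `ThetaEq Ψ p q` says that `θ_Ψ(p) = q`, where `θ_Ψ` is the map `φ ↦ φ ∘ Ψ⁻¹` on characters,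
read through the identification of characters with points: there is a character at the point `p`
(it is unique, by `charPoint_injective`), and its image under `φ ↦ φ ∘ Ψ⁻¹` is at `q`. -/
def ThetaEq {u : UMat n m} {v : UMat n' m'} (Ψ : Alg u ≃ₐ[ℂ] Alg v) (p : Pt n m) (q : Pt n' m') :
    Prop :=
  ∃ φ : Alg u →ₐ[ℂ] ℂ, charPoint u φ = p ∧
    charPoint v (φ.comp Ψ.symm.toAlgHom) = q

/-- The subspace of homogeneous elements of `𝒜_u` of total degree `N`, spanned by the products
`L_{e_{i_1}} ⋯ L_{e_{i_k}} L_{f_{j_1}} ⋯ L_{f_{j_l}}` with `k + l = N`. -/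
def gradedPart (u : UMat n m) (N : ℕ) : Submodule ℂ (Alg u) :=
  Submodule.span ℂ {X | ∃ a : List (Fin n), ∃ b : List (Fin m), a.length + b.length = N ∧
    X = (a.map (genE u)).prod * (b.map (genF u)).prod}

/-- An isomorphism is graded if it respects the gradings by total degree. -/
def IsGraded {u : UMat n m} {v : UMat n' m'} (Ψ : Alg u ≃ₐ[ℂ] Alg v) : Prop :=
  ∀ N, (gradedPart u N).map Ψ.toAlgHom.toLinearMap = gradedPart v N

/-- A unitary matrix, with possibly different index sets for the rows and the columns (which
then have the same cardinality). -/
def IsUnitaryMat {ι κ : Type} [Fintype ι] [Fintype κ] [DecidableEq ι] [DecidableEq κ]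
    (A : Matrix ι κ ℂ) : Prop :=
  A * A.conjTranspose = 1 ∧ A.conjTranspose * A = 1

/-- Bigraded isomorphisms (the unitarity of `A` and `B` forces `n = n'` and `m = m'`). -/
def IsBigraded {u : UMat n m} {v : UMat n' m'} (Ψ : Alg u ≃ₐ[ℂ] Alg v) : Prop :=
  ∃ (A : Matrix (Fin n) (Fin n') ℂ) (B : Matrix (Fin m) (Fin m') ℂ),
    IsUnitaryMat A ∧ IsUnitaryMat B ∧
    (∀ i, Ψ (genE u i) = ∑ j, A i j • genE v j) ∧
    (∀ k, Ψ (genF u k) = ∑ l, B k l • genF v l)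

/-- Graded exchange isomorphisms (the unitarity of `A` and `B` forces `n = m'` and `m = n'`). -/
def IsGradedExchange {u : UMat n m} {v : UMat n' m'} (Ψ : Alg u ≃ₐ[ℂ] Alg v) : Prop :=
  IsGraded Ψ ∧ ∃ (A : Matrix (Fin n) (Fin m') ℂ) (B : Matrix (Fin m) (Fin n') ℂ),
    IsUnitaryMat A ∧ IsUnitaryMat B ∧
    (∀ i, Ψ (genE u i) = ∑ j, A i j • genF v j) ∧
    (∀ k, Ψ (genF u k) = ∑ l, B k l • genE v l)

end UnitaryRelation

end

open UnitaryRelation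

/-! Characters of a Banach algebra are contractive, so the character space of `Alg u` is exactly
`Omega u`: the points with `‖z‖ < 1`, `‖w‖ < 1` come from joint eigenvectors of the adjoints of the
generators (`exists_char_of_norm_lt_one`), the others by compactness. Elements of `Alg u` restrict
to functions on `Omega u` that are holomorphic along its discs, so `θ_Ψ` and its inverse are
holomorphic there, whether or not `Ψ` is continuous (`biholo_theta`).

Parts 1 and 2 then follow from geometry alone (`Biholo.exists_isometries`). `Omega u` contains both
unit balls and is stable under `(z, w) ↦ (s z, t w)` inside the product of the balls. Schwarz's
lemma for `θ` and its inverse shows that `θ`, and hence its derivative `M` at the origin, preserves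
the max norm. The parallelogram law forces `M` to send the two components of a point into different
factors. Euclidean balls are strictly convex, so equality in Schwarz's lemma makes `θ` linear on
each bidisc, and `θ = M` everywhere. An invertible linear map of this kind preserves or exchanges
the two factors, isometrically.

For part 3, the derivative of `θ` determines the degree-one coefficients of `Ψ(L_{e_i})` applied to
the vacuum. Those belonging to one factor form a row of a unitary matrix, so they already have norm
1. As `Ψ(L_{e_i})` is a contraction, nothing else can occur in its vacuum vector. The vacuum
separates the algebra (`eq_zero_of_apply_vac`), so `Ψ(L_{e_i})` is the expected linear combination
of generators; the same holds for `Ψ(L_{f_k})`. -/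

noncomputable section

open scoped ComplexConjugate Topology
open Metric Set Filter

namespace CircledHolo

/-! ### Rigidity in the Schwarz lemma on discs and bidiscs. -/

section Disc

variable {G : Type*} [NormedAddCommGroup G] [InnerProductSpace ℂ G]

theorem strictConvexSpace_real : StrictConvexSpace ℝ G :=
  letI := NormedSpace.restrictScalars ℝ ℂ G
  letI := InnerProductSpace.rclikeToReal ℂ G
  inferInstance

/-- Equality case of the Schwarz lemma: a holomorphic map of the unit disc into the unit ball of an
inner product space whose derivative at `0` is a unit vector is linear. -/
theorem eq_smul_of_norm_deriv_eq_one {f : ℂ → G} (hd : DifferentiableOn ℂ f (ball 0 1))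
    (hf : ∀ s ∈ ball (0 : ℂ) 1, ‖f s‖ ≤ 1) (h0 : f 0 = 0) {x : G} (hx : HasDerivAt f x 0)
    (hx1 : ‖x‖ = 1) {s : ℂ} (hs : ‖s‖ < 1) : f s = s • x := by
  have : StrictConvexSpace ℝ G := strictConvexSpace_real
  have h := Complex.affine_of_mapsTo_ball_of_norm_dslope_eq_div (z₀ := 0) (R₂ := 1) hd
    (fun s hs => by simpa [h0] using hf s hs) (by simp) (by simp [hx.deriv, hx1])
  have := h (mem_ball_zero_iff.2 hs)
  simpa [h0, hx.deriv] using this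

/-- A function of two variables is holomorphic along all holomorphic discs in the open bidisc. -/
def SliceHolo {G : Type*} [NormedAddCommGroup G] [NormedSpace ℂ G] (f : ℂ → ℂ → G) : Prop :=
  ∀ (U : Set ℂ), IsOpen U → ∀ g₁ g₂ : ℂ → ℂ, DifferentiableOn ℂ g₁ U → DifferentiableOn ℂ g₂ U →
    (∀ σ ∈ U, ‖g₁ σ‖ < 1 ∧ ‖g₂ σ‖ < 1) → DifferentiableOn ℂ (fun σ => f (g₁ σ) (g₂ σ)) U

theorem SliceHolo.swap {G : Type*} [NormedAddCommGroup G] [NormedSpace ℂ G] {f : ℂ → ℂ → G} (hf : SliceHolo f) : SliceHolo (fun s t => f t s) :=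
  fun U hU g₁ g₂ h₁ h₂ h => hf U hU g₂ g₁ h₂ h₁ fun σ hσ => (h σ hσ).symm

/-- A map of the bidisc into the unit ball of an inner product space, whose derivative at `0` along
the discs `s ↦ (s, ts)` is the same unit vector `x` for all `t`, is `(s, t) ↦ s x`. -/
theorem eq_smul_of_slices [CompleteSpace G] {f : ℂ → ℂ → G} (hf : SliceHolo f)
    (h1 : ∀ s t : ℂ, ‖s‖ < 1 → ‖t‖ < 1 → ‖f s t‖ ≤ 1) (h0 : f 0 0 = 0) {x : G} (hx : ‖x‖ = 1)
    (hd : ∀ t : ℂ, ‖t‖ ≤ 1 → HasDerivAt (fun s => f s (s * t)) x 0) {s t : ℂ} (hs : ‖s‖ < 1)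
    (ht : ‖t‖ < 1) : f s t = s • x := by
  have key : ∀ s t : ℂ, ‖s‖ < 1 → ‖t‖ ≤ 1 → f s (s * t) = s • x := by
    intro s t hs ht
    have hlt : ∀ σ ∈ ball (0 : ℂ) 1, ‖σ‖ < 1 ∧ ‖σ * t‖ < 1 := by
      intro σ hσ
      have h := mem_ball_zero_iff.1 hσ
      refine ⟨h, ?_⟩
      rw [norm_mul]
      nlinarith [norm_nonneg σ, norm_nonneg t]
    refine eq_smul_of_norm_deriv_eq_one (f := fun s => f s (s * t)) ?_ ?_ (by simpa using h0)
      (hd t ht) hx hs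
    · exact hf _ isOpen_ball (fun σ => σ) (fun σ => σ * t) differentiableOn_id
        (by fun_prop) hlt
    · exact fun σ hσ => h1 _ _ (hlt σ hσ).1 (hlt σ hσ).2
  have h2 : DifferentiableOn ℂ (fun σ => f σ t) (ball 0 1) :=
    hf _ isOpen_ball (fun σ => σ) (fun _ => t) differentiableOn_id (by fun_prop)
      fun σ hσ => ⟨mem_ball_zero_iff.1 hσ, ht⟩
  have h3 : DifferentiableOn ℂ (fun σ : ℂ => σ • x) (ball 0 1) := by fun_prop
  -- For `‖t‖ < ‖σ‖ < 1` the point `(σ, t)` lies on the disc `s ↦ (s, s (t / σ))`, which `key`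
  -- covers. The identity theorem, based at the point `c` of this annulus, extends the formula to
  -- all `σ` in the unit disc.
  set c : ℝ := (1 + ‖t‖) / 2 with hc
  have hc1 : c < 1 := by rw [hc]; linarith
  have hct : ‖t‖ < c := by rw [hc]; linarith
  have hc0 : 0 < c := (norm_nonneg t).trans_lt hct
  have hnc : ‖(c : ℂ)‖ = c := by simp [abs_of_pos hc0]
  refine AnalyticOnNhd.eqOn_of_preconnected_of_eventuallyEq (h2.analyticOnNhd isOpen_ball)
    (h3.analyticOnNhd isOpen_ball) (convex_ball (0 : ℂ) 1).isPreconnected (z₀ := (c : ℂ))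
    (by rw [mem_ball_zero_iff, hnc]; exact hc1) ?_ (mem_ball_zero_iff.2 hs)
  have ho : IsOpen {σ : ℂ | ‖t‖ < ‖σ‖ ∧ ‖σ‖ < 1} :=
    (isOpen_lt continuous_const continuous_norm).inter (isOpen_lt continuous_norm continuous_const)
  filter_upwards [ho.mem_nhds (x := (c : ℂ)) ⟨by rw [hnc]; exact hct, by rw [hnc]; exact hc1⟩]
    with σ hσ
  have hσ0 : σ ≠ 0 := norm_pos_iff.1 ((norm_nonneg t).trans_lt hσ.1)
  have := key σ (t / σ) hσ.2 (by
    rw [norm_div]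
    exact (div_le_one (norm_pos_iff.2 hσ0)).2 hσ.1.le)
  rwa [mul_div_cancel₀ _ hσ0] at this

/-- If `x ± y` lie in the unit ball of an inner product space, then `‖x‖² + ‖y‖² ≤ 1`. -/
theorem norm_sq_add_norm_sq_le_one {x y : G} (h1 : ‖x + y‖ ≤ 1) (h2 : ‖x - y‖ ≤ 1) :
    ‖x‖ ^ 2 + ‖y‖ ^ 2 ≤ 1 := by
  have := parallelogram_law_with_norm ℂ x y
  nlinarith [norm_nonneg (x + y), norm_nonneg (x - y)]

end Disc

/-! ### Circled sets, norm preservation and unit pairs. -/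

variable {E F E' F' : Type*}
  [NormedAddCommGroup E] [InnerProductSpace ℂ E] [NormedAddCommGroup F] [InnerProductSpace ℂ F]
  [NormedAddCommGroup E'] [InnerProductSpace ℂ E'] [NormedAddCommGroup F'] [InnerProductSpace ℂ F']

/-- Subsets of a product of two unit balls which contain both factors and are circled in each
variable separately. -/
structure Circled (Ω : Set (E × F)) : Prop where
  norm_le : ∀ p ∈ Ω, ‖p‖ ≤ 1
  smul_mem : ∀ p ∈ Ω, ∀ s t : ℂ, ‖s • p.1‖ ≤ 1 → ‖t • p.2‖ ≤ 1 → (s • p.1, t • p.2) ∈ Ω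
  left_mem : ∀ z : E, ‖z‖ ≤ 1 → (z, 0) ∈ Ω
  right_mem : ∀ w : F, ‖w‖ ≤ 1 → (0, w) ∈ Ω

/-- A map `θ : Ω → Ω'` which fixes the origin, is holomorphic along the bidiscs in `Ω`, is radially
continuous at the boundary, and has derivative `M` at the origin. -/
structure Holo (Ω : Set (E × F)) (Ω' : Set (E' × F')) (θ : E × F → E' × F')
    (M : E × F →ₗ[ℂ] E' × F') : Prop where
  mem : ∀ p ∈ Ω, θ p ∈ Ω'
  zero : θ 0 = 0
  slice : ∀ p ∈ Ω, SliceHolo fun s t => θ (s • p.1, t • p.2)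
  deriv : ∀ p ∈ Ω, HasDerivAt (fun s : ℂ => θ (s • p)) (M p) 0
  tendsto : ∀ p ∈ Ω, Tendsto (fun s : ℝ => θ ((s : ℂ) • p)) (𝓝[<] 1) (𝓝 (θ p))

/-- A pair of mutually inverse maps as in `Holo`. -/
structure Biholo (Ω : Set (E × F)) (Ω' : Set (E' × F')) (θ : E × F → E' × F')
    (θ' : E' × F' → E × F) (M : E × F →ₗ[ℂ] E' × F') (M' : E' × F' →ₗ[ℂ] E × F) : Prop where
  circled : Circled Ω
  circled' : Circled Ω'
  holo : Holo Ω Ω' θ M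
  holo' : Holo Ω' Ω θ' M'
  left_inv : ∀ p ∈ Ω, θ' (θ p) = p
  right_inv : ∀ p ∈ Ω', θ (θ' p) = p

theorem Circled.swap {Ω : Set (E × F)} (h : Circled Ω) : Circled (Prod.swap ⁻¹' Ω) where
  norm_le p hp := by
    have := h.norm_le _ hp
    rw [Prod.norm_def] at this ⊢
    rwa [max_comm]
  smul_mem p hp s t hs ht := h.smul_mem _ hp t s ht hs
  left_mem z hz := h.right_mem z hz
  right_mem w hw := h.left_mem w hw

theorem Circled.smul_mem_of_norm_le_one {Ω : Set (E × F)} (h : Circled Ω) {p : E × F} (hp : p ∈ Ω)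
    {s t : ℂ} (hs : ‖s‖ ≤ 1) (ht : ‖t‖ ≤ 1) : (s • p.1, t • p.2) ∈ Ω := by
  have h1 := h.norm_le p hp
  refine h.smul_mem p hp s t ?_ ?_ <;> rw [norm_smul]
  · exact mul_le_one₀ hs (norm_nonneg _) ((norm_fst_le p).trans h1)
  · exact mul_le_one₀ ht (norm_nonneg _) ((norm_snd_le p).trans h1)

theorem Circled.smul_mem' {Ω : Set (E × F)} (h : Circled Ω) {p : E × F} (hp : p ∈ Ω)
    {s : ℂ} (hs : ‖s • p‖ ≤ 1) : s • p ∈ Ω :=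
  h.smul_mem p hp s s ((norm_fst_le (s • p)).trans hs) ((norm_snd_le (s • p)).trans hs)

variable {Ω : Set (E × F)} {Ω' : Set (E' × F')} {θ : E × F → E' × F'} {θ' : E' × F' → E × F}
  {M : E × F →ₗ[ℂ] E' × F'} {M' : E' × F' →ₗ[ℂ] E × F}

theorem hasDerivAt_swap {f : ℂ → E × F} {x : E × F} {s : ℂ} (h : HasDerivAt f x s) :
    HasDerivAt (fun s => (f s).swap) x.swap s :=
  ((ContinuousLinearEquiv.prodComm ℂ E F).toContinuousLinearMap).hasFDerivAt.comp_hasDerivAt s h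

theorem Holo.swap_codomain (h : Holo Ω Ω' θ M) :
    Holo Ω (Prod.swap ⁻¹' Ω') (Prod.swap ∘ θ)
      ((LinearEquiv.prodComm ℂ E' F').toLinearMap ∘ₗ M) where
  mem p hp := by simpa using h.mem p hp
  zero := by simp [h.zero]
  slice p hp U hU g₁ g₂ h₁ h₂ h₃ :=
    (ContinuousLinearEquiv.prodComm ℂ E' F').toContinuousLinearMap.differentiable.comp_differentiableOn
      (h.slice p hp U hU g₁ g₂ h₁ h₂ h₃)
  deriv p hp := hasDerivAt_swap (h.deriv p hp)
  tendsto p hp := (continuous_swap.tendsto _).comp (h.tendsto p hp)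

theorem Holo.swap_domain (h : Holo Ω Ω' θ M) :
    Holo (Prod.swap ⁻¹' Ω) Ω' (θ ∘ Prod.swap)
      (M ∘ₗ (LinearEquiv.prodComm ℂ F E).toLinearMap) where
  mem _ hp := h.mem _ hp
  zero := h.zero
  slice _ hp := (h.slice _ hp).swap
  deriv _ hp := h.deriv _ hp
  tendsto _ hp := h.tendsto _ hp

theorem Biholo.symm (h : Biholo Ω Ω' θ θ' M M') : Biholo Ω' Ω θ' θ M' M :=
  ⟨h.circled', h.circled, h.holo', h.holo, h.right_inv, h.left_inv⟩

/-- Together with `symm` and `swap_domain`, this reduces every statement about a choice of source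
and target factor to one of the four choices. -/
theorem Biholo.swap_codomain (h : Biholo Ω Ω' θ θ' M M') :
    Biholo Ω (Prod.swap ⁻¹' Ω') (Prod.swap ∘ θ) (θ' ∘ Prod.swap)
      ((LinearEquiv.prodComm ℂ E' F').toLinearMap ∘ₗ M)
      (M' ∘ₗ (LinearEquiv.prodComm ℂ F' E').toLinearMap) :=
  ⟨h.circled, h.circled'.swap, h.holo.swap_codomain, h.holo'.swap_domain,
    fun p hp => by simp [h.left_inv p hp],
    fun p hp => by
      have := h.right_inv p.swap hp
      simp [this]⟩

theorem Biholo.swap_domain (h : Biholo Ω Ω' θ θ' M M') :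
    Biholo (Prod.swap ⁻¹' Ω) Ω' (θ ∘ Prod.swap) (Prod.swap ∘ θ')
      (M ∘ₗ (LinearEquiv.prodComm ℂ F E).toLinearMap)
      ((LinearEquiv.prodComm ℂ E F).toLinearMap ∘ₗ M') :=
  h.symm.swap_codomain.symm

theorem Holo.slice_smul (h : Holo Ω Ω' θ M) {p : E × F} (hp : p ∈ Ω) :
    DifferentiableOn ℂ (fun s : ℂ => θ (s • p)) (ball 0 1) :=
  h.slice p hp _ isOpen_ball id id differentiableOn_id differentiableOn_id
    fun _ hσ => ⟨mem_ball_zero_iff.1 hσ, mem_ball_zero_iff.1 hσ⟩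

/-- Schwarz's lemma on the disc through `p / ‖p‖`, in the max norm. This point lies in `Ω` because
`Circled.smul_mem` restricts only the norms of the scaled components, not the scalars. -/
theorem Holo.norm_apply_le (h : Holo Ω Ω' θ M) (hc : Circled Ω) (hc' : Circled Ω') {p : E × F}
    (hp : p ∈ Ω) : ‖θ p‖ ≤ ‖p‖ := by
  rcases eq_or_ne p 0 with rfl | hp0
  · simp [h.zero]
  rcases (hc.norm_le p hp).eq_or_lt with h1 | h1
  · rw [h1]
    exact hc'.norm_le _ (h.mem p hp)
  have hn : ‖p‖ ≠ 0 := norm_ne_zero_iff.2 hp0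
  have hq : ((‖p‖ : ℂ)⁻¹) • p ∈ Ω := hc.smul_mem' hp (by simp [norm_smul, hn])
  have := Complex.norm_le_norm_of_mapsTo_ball (R := 1) (z := (‖p‖ : ℂ)) (h.slice_smul hq) (by
      intro s hs
      rw [mem_closedBall_zero_iff]
      have hs' : ‖s‖ ≤ 1 := (mem_ball_zero_iff.1 hs).le
      exact hc'.norm_le _ (h.mem _ (hc.smul_mem_of_norm_le_one hq hs' hs')))
    (by simp [h.zero]) (by simpa using h1)
  simpa [smul_smul, hn] using this

theorem Biholo.norm_apply (h : Biholo Ω Ω' θ θ' M M') {p : E × F} (hp : p ∈ Ω) :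
    ‖θ p‖ = ‖p‖ := by
  refine le_antisymm (h.holo.norm_apply_le h.circled h.circled' hp) ?_
  have := h.holo'.norm_apply_le h.circled' h.circled (h.holo.mem p hp)
  rwa [h.left_inv p hp] at this

/-- The difference quotients of `s ↦ θ (s • p)` at `0` all have norm `‖p‖`, since `θ` preserves the
norm. -/
theorem Biholo.norm_deriv (h : Biholo Ω Ω' θ θ' M M') {p : E × F} (hp : p ∈ Ω) :
    ‖M p‖ = ‖p‖ := by
  have h1 := (h.holo.deriv p hp).tendsto_slope_zero.norm
  refine tendsto_nhds_unique h1 (tendsto_const_nhds.congr' ?_)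
  have hb : ball (0 : ℂ) 1 ∈ 𝓝 (0 : ℂ) := ball_mem_nhds _ one_pos
  filter_upwards [nhdsWithin_le_nhds hb, self_mem_nhdsWithin] with s hs hs0
  have hs' : ‖s‖ ≤ 1 := (mem_ball_zero_iff.1 hs).le
  have hs0' : ‖s‖ ≠ 0 := norm_ne_zero_iff.2 hs0
  have := h.norm_apply (h.circled.smul_mem_of_norm_le_one hp hs' hs')
  have h2 : ‖θ (s • p)‖ = ‖s‖ * ‖p‖ := by rw [← norm_smul]; exact this
  simp [h.holo.zero, norm_smul, h2, hs0']

theorem hasDerivAt_fst {f : ℂ → E × F} {x : E × F} {s : ℂ} (h : HasDerivAt f x s) :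
    HasDerivAt (fun s => (f s).1) x.1 s :=
  (ContinuousLinearMap.fst ℂ E F).hasFDerivAt.comp_hasDerivAt s h

/-- If the derivative at the origin maps `(a, 0)` to a point with unit first component and `(0, b)`
into the second factor, then the first component of `θ` is linear on the bidisc through `(a, b)`. -/
theorem Biholo.fst_eq_of_unit [CompleteSpace E'] (h : Biholo Ω Ω' θ θ' M M') {a : E} {b : F}
    (hab : (a, b) ∈ Ω) (h1 : ‖(M (a, 0)).1‖ = 1) (h2 : (M (0, b)).1 = 0) {s t : ℂ} (hs : ‖s‖ < 1)
    (ht : ‖t‖ < 1) : (θ (s • a, t • b)).1 = s • (M (a, 0)).1 := by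
  refine eq_smul_of_slices (f := fun s t => (θ (s • a, t • b)).1) ?_ ?_ ?_ h1 ?_ hs ht
  · intro U hU g₁ g₂ h₁ h₂ h₃
    exact (ContinuousLinearMap.fst ℂ E' F').differentiable.comp_differentiableOn
      (h.holo.slice _ hab U hU g₁ g₂ h₁ h₂ h₃)
  · intro s t hs ht
    exact (norm_fst_le _).trans (h.circled'.norm_le _ (h.holo.mem _
      (h.circled.smul_mem_of_norm_le_one hab hs.le ht.le)))
  · have := h.holo.zero
    rw [Prod.mk_zero_zero.symm] at this
    simp [this]
  · intro t ht
    have hm : (a, t • b) ∈ Ω := by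
      simpa using h.circled.smul_mem_of_norm_le_one hab (s := 1) (by simp) ht
    have h3 := hasDerivAt_fst (h.holo.deriv _ hm)
    have h4 : M (a, t • b) = M (a, 0) + t • M (0, b) := by
      rw [← map_smul, ← map_add]; simp
    simpa [h4, h2, smul_smul] using h3

/-- The behaviour of `θ` on the bidisc through a point with two unit components. -/
theorem Biholo.unit_cases (h : Biholo Ω Ω' θ θ' M M') {a : E} {b : F}
    (hab : (a, b) ∈ Ω) (ha : ‖a‖ = 1) (hb : ‖b‖ = 1) :
    (‖(M (a, 0)).1‖ = 1 ∧ (M (a, 0)).2 = 0 ∧ (M (0, b)).1 = 0 ∧ ‖(M (0, b)).2‖ = 1) ∨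
    (‖(M (a, 0)).2‖ = 1 ∧ (M (a, 0)).1 = 0 ∧ (M (0, b)).2 = 0 ∧ ‖(M (0, b)).1‖ = 1) := by
  -- Since `(a, ±b)` lie in `Ω`, the vectors `M (a, 0) ± M (0, b)` lie in the unit ball of either
  -- factor. By the parallelogram law, where one of `M (a, 0)`, `M (0, b)` has a unit component, the
  -- other has component zero.
  have hs : (a, -b) ∈ Ω := by
    simpa using h.circled.smul_mem_of_norm_le_one hab (s := 1) (t := -1) (by simp) (by simp)
  have e1 : M (a, b) = M (a, 0) + M (0, b) := by rw [← map_add]; simp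
  have e2 : M (a, -b) = M (a, 0) - M (0, b) := by rw [← map_sub]; simp
  have n1 := (h.norm_deriv hab).le.trans (h.circled.norm_le _ hab)
  have n2 := (h.norm_deriv hs).le.trans (h.circled.norm_le _ hs)
  have n3 := h.norm_deriv (h.circled.left_mem a ha.le)
  have n4 := h.norm_deriv (h.circled.right_mem b hb.le)
  rw [e1, Prod.norm_def, max_le_iff] at n1
  rw [e2, Prod.norm_def, max_le_iff] at n2
  have q1 := norm_sq_add_norm_sq_le_one n1.1 n2.1
  have q2 := norm_sq_add_norm_sq_le_one n1.2 n2.2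
  simp only [Prod.norm_def, norm_zero, ha, hb] at n3 n4
  norm_num at n3 n4
  have z : ∀ {x y : ℝ}, 0 ≤ y → x ^ 2 + y ^ 2 ≤ 1 → x = 1 → y = 0 := by
    rintro x y hy h rfl
    nlinarith
  rcases max_choice ‖(M (a, 0)).1‖ ‖(M (a, 0)).2‖ with h5 | h5
  · left
    rw [h5] at n3
    have h6 := z (norm_nonneg _) q1 n3
    rw [h6, max_eq_right (norm_nonneg _)] at n4
    rw [add_comm] at q2
    exact ⟨n3, norm_eq_zero.1 (z (norm_nonneg _) q2 n4), norm_eq_zero.1 h6, n4⟩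
  · right
    rw [h5] at n3
    have h6 := z (norm_nonneg _) q2 n3
    rw [h6, max_eq_left (norm_nonneg _)] at n4
    rw [add_comm] at q1
    exact ⟨n3, norm_eq_zero.1 (z (norm_nonneg _) q1 n4), norm_eq_zero.1 h6, n4⟩

variable [CompleteSpace E'] [CompleteSpace F']

/-- By `unit_cases` each component of `M` sees only one of the two variables and takes it to a unit
vector, so `fst_eq_of_unit`, used for each component after suitable swaps, applies. -/
theorem Biholo.eq_of_unit (h : Biholo Ω Ω' θ θ' M M') {a : E} {b : F}
    (hab : (a, b) ∈ Ω) (ha : ‖a‖ = 1) (hb : ‖b‖ = 1) {s t : ℂ} (hs : ‖s‖ < 1)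
    (ht : ‖t‖ < 1) : θ (s • a, t • b) = M (s • a, t • b) := by
  have e : M (s • a, t • b) = s • M (a, 0) + t • M (0, b) := by
    rw [← map_smul, ← map_smul, ← map_add]; simp
  have hba : (b, a) ∈ Prod.swap ⁻¹' Ω := hab
  rw [e]
  rcases h.unit_cases hab ha hb with ⟨h1, h2, h3, h4⟩ | ⟨h1, h2, h3, h4⟩
  · have k1 := h.fst_eq_of_unit hab h1 h3 hs ht
    have k2 := h.swap_codomain.swap_domain.fst_eq_of_unit hba (by simpa using h4)
      (by simpa using h2) ht hs
    ext <;> simp_all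
  · have k1 := h.swap_domain.fst_eq_of_unit hba (by simpa using h4) (by simpa using h2) ht hs
    have k2 := h.swap_codomain.fst_eq_of_unit hab (by simpa using h1) (by simpa using h3) hs ht
    ext <;> simp_all

end CircledHolo

/-! ### Points on a single factor, and linearity of the whole map. -/

namespace CircledHolo

variable {E F E' F' : Type*}
  [NormedAddCommGroup E] [InnerProductSpace ℂ E] [NormedAddCommGroup F] [InnerProductSpace ℂ F]
  [NormedAddCommGroup E'] [InnerProductSpace ℂ E'] [NormedAddCommGroup F'] [InnerProductSpace ℂ F']
  {Ω : Set (E × F)} {Ω' : Set (E' × F')} {θ : E × F → E' × F'} {θ' : E' × F' → E × F}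
  {M : E × F →ₗ[ℂ] E' × F'} {M' : E' × F' →ₗ[ℂ] E × F}

theorem linearMap_mk_smul {G : Type*} [AddCommGroup G] [Module ℂ G] (f : E × F →ₗ[ℂ] G) (s t : ℂ)
    (a : E) (b : F) : f (s • a, t • b) = s • f (a, 0) + t • f (0, b) := by
  rw [← map_smul, ← map_smul, ← map_add]; simp

theorem norm_inv_norm_smul {G : Type*} [NormedAddCommGroup G] [NormedSpace ℂ G] {x : G}
    (hx : x ≠ 0) : ‖(‖x‖ : ℂ)⁻¹ • x‖ = 1 := by
  simp [norm_smul, norm_ne_zero_iff.2 hx]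

theorem norm_smul_inv_norm_smul {G : Type*} [NormedAddCommGroup G] [NormedSpace ℂ G] (x : G) :
    (‖x‖ : ℂ) • (‖x‖ : ℂ)⁻¹ • x = x := by
  rcases eq_or_ne x 0 with rfl | hx
  · simp
  · simp [smul_smul, norm_ne_zero_iff.2 hx]

/-- `Ω` need not contain a pair `(z, b)` with `b ≠ 0`, so `eq_of_unit` is not available for `θ`. It
is used for `θ'` instead: if `θ (s • z, 0)` had a second component `b ≠ 0`, it would lie on the
bidisc through a unit pair of `Ω'`. There `θ'` is linear and sends the two variables to different
factors, so both components of the preimage would be nonzero, whereas the preimage is `(s • z, 0)`.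
-/
theorem Biholo.left_of_norm_fst [CompleteSpace E] [CompleteSpace F] (h : Biholo Ω Ω' θ θ' M M')
    {z : E} (hz : ‖z‖ = 1) (h1 : ‖(M (z, 0)).1‖ = 1) :
    (M (z, 0)).2 = 0 ∧ ∀ s : ℂ, ‖s‖ < 1 → θ (s • z, 0) = s • M (z, 0) := by
  have hzm : (z, 0) ∈ Ω := h.circled.left_mem z hz.le
  have hd := h.holo.deriv _ hzm
  have hdiff := h.holo.slice_smul hzm
  simp only [Prod.smul_mk, smul_zero] at hd hdiff
  have h00 : θ (0, 0) = 0 := h.holo.zero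
  have hsm : ∀ s : ℂ, ‖s‖ < 1 → (s • z, (0 : F)) ∈ Ω := fun s hs =>
    h.circled.left_mem _ (by rw [norm_smul, hz, mul_one]; exact hs.le)
  have hfst : ∀ s : ℂ, ‖s‖ < 1 → (θ (s • z, 0)).1 = s • (M (z, 0)).1 := by
    intro s hs
    refine eq_smul_of_norm_deriv_eq_one (f := fun s : ℂ => (θ (s • z, 0)).1)
      ((ContinuousLinearMap.fst ℂ E' F').differentiable.comp_differentiableOn hdiff) ?_ ?_
      (hasDerivAt_fst hd) h1 hs
    · intro s hs
      exact (norm_fst_le _).trans (h.circled'.norm_le _ (h.holo.mem _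
        (hsm s (mem_ball_zero_iff.1 hs))))
    · simp [h00]
  have hsnd : ∀ s : ℂ, ‖s‖ < 1 → (θ (s • z, 0)).2 = 0 := by
    intro s hs
    by_contra hb
    set b := (θ (s • z, 0)).2 with hbdef
    have hs0 : s ≠ 0 := by
      rintro rfl
      exact hb (by rw [hbdef]; simp [h00])
    have hmem := h.holo.mem _ (hsm s hs)
    have hθ : θ (s • z, 0) = (s • (M (z, 0)).1, b) := Prod.ext (hfst s hs) rfl
    have hlt : ‖b‖ < 1 := by
      have := h.norm_apply (hsm s hs)
      rw [hθ, Prod.norm_def, Prod.norm_def] at this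
      simp only [norm_smul, h1, hz, mul_one, norm_zero, norm_nonneg, sup_of_le_left] at this
      exact ((le_max_right _ _).trans this.le).trans_lt hs
    rw [hθ] at hmem
    have hu : ((M (z, 0)).1, (‖b‖ : ℂ)⁻¹ • b) ∈ Ω' := by
      have := h.circled'.smul_mem _ hmem s⁻¹ ((‖b‖ : ℂ)⁻¹)
        (by simp [smul_smul, hs0, h1]) (norm_inv_norm_smul hb).le
      simpa [smul_smul, hs0] using this
    have hinv : θ' (s • (M (z, 0)).1, (‖b‖ : ℂ) • (‖b‖ : ℂ)⁻¹ • b) = (s • z, 0) := by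
      rw [norm_smul_inv_norm_smul, ← hθ]
      exact h.left_inv _ (hsm s hs)
    have hub := norm_inv_norm_smul hb
    rw [h.symm.eq_of_unit hu h1 hub hs (by simpa using hlt), linearMap_mk_smul] at hinv
    have i1 := congrArg Prod.snd hinv
    simp only [Prod.snd_add, Prod.smul_snd] at i1
    rcases h.symm.unit_cases hu h1 hub with ⟨-, h2, -, h4⟩ | ⟨h2, -, h4, -⟩
    · rw [h2, smul_zero, zero_add, smul_eq_zero] at i1
      rcases i1 with i1 | i1
      · exact hb (by simpa using i1)
      · rw [i1] at h4
        simp at h4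
    · rw [h4, smul_zero, add_zero, smul_eq_zero] at i1
      rcases i1 with i1 | i1
      · exact hs0 i1
      · rw [i1] at h2
        simp at h2
  have h2 : (M (z, 0)).2 = 0 := by
    have hd2 : HasDerivAt (fun s : ℂ => (θ (s • z, 0)).2) (M (z, 0)).2 0 :=
      (ContinuousLinearMap.snd ℂ E' F').hasFDerivAt.comp_hasDerivAt 0 hd
    refine hd2.unique ((hasDerivAt_const (0 : ℂ) (0 : F')).congr_of_eventuallyEq ?_)
    filter_upwards [ball_mem_nhds (0 : ℂ) one_pos] with s hs
    exact hsnd s (mem_ball_zero_iff.1 hs)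
  refine ⟨h2, fun s hs => Prod.ext (hfst s hs) ?_⟩
  rw [hsnd s hs, Prod.smul_snd, h2, smul_zero]

theorem Biholo.left_of_norm_eq_one [CompleteSpace E] [CompleteSpace F]
    (h : Biholo Ω Ω' θ θ' M M') {z : E} (hz : ‖z‖ = 1) :
    ((M (z, 0)).2 = 0 ∨ (M (z, 0)).1 = 0) ∧
      ∀ s : ℂ, ‖s‖ < 1 → θ (s • z, 0) = s • M (z, 0) := by
  have hn := h.norm_deriv (h.circled.left_mem z hz.le)
  simp only [Prod.norm_def, norm_zero, hz] at hn
  norm_num at hn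
  rcases max_choice ‖(M (z, 0)).1‖ ‖(M (z, 0)).2‖ with h5 | h5
  · rw [h5] at hn
    exact ⟨Or.inl (h.left_of_norm_fst hz hn).1, (h.left_of_norm_fst hz hn).2⟩
  · rw [h5] at hn
    obtain ⟨k1, k2⟩ := h.swap_codomain.left_of_norm_fst hz (by simpa using hn)
    refine ⟨Or.inr (by simpa using k1), fun s hs => ?_⟩
    exact Prod.swap_injective (by simpa using k2 s hs)

theorem Biholo.left_eq [CompleteSpace E] [CompleteSpace F] (h : Biholo Ω Ω' θ θ' M M')
    {z : E} (hz : ‖z‖ < 1) : θ (z, 0) = M (z, 0) := by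
  rcases eq_or_ne z 0 with rfl | hz0
  · exact h.holo.zero.trans (map_zero M).symm
  · have := (h.left_of_norm_eq_one (norm_inv_norm_smul hz0)).2 (‖z‖ : ℂ) (by simpa using hz)
    rw [norm_smul_inv_norm_smul, ← map_smul] at this
    simpa [smul_smul, norm_ne_zero_iff.2 hz0] using this

/-- `E` is the union of the kernels of the two components of `z ↦ M (z, 0)`, and a vector space is
not the union of two proper subspaces. -/
theorem Biholo.left_cases [CompleteSpace E] [CompleteSpace F] (h : Biholo Ω Ω' θ θ' M M') :
    (∀ z, (M (z, 0)).2 = 0) ∨ (∀ z, (M (z, 0)).1 = 0) := by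
  have key : ∀ z, (M (z, 0)).2 = 0 ∨ (M (z, 0)).1 = 0 := by
    intro z
    rcases eq_or_ne z 0 with rfl | hz0
    · left
      exact congrArg Prod.snd (map_zero M)
    · have := (h.left_of_norm_eq_one (norm_inv_norm_smul hz0)).1
      have e : M ((‖z‖ : ℂ)⁻¹ • z, 0) = (‖z‖ : ℂ)⁻¹ • M (z, 0) := by rw [← map_smul]; simp
      simpa [e, hz0] using this
  by_contra! hcon
  obtain ⟨⟨z, hz⟩, ⟨y, hy⟩⟩ := hcon
  have e : M (z + y, 0) = M (z, 0) + M (y, 0) := by rw [← map_add]; simp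
  have kz := (key z).resolve_left hz
  have ky := (key y).resolve_right hy
  rcases key (z + y) with k | k
  · rw [e, Prod.snd_add, ky, add_zero] at k
    exact hz k
  · rw [e, Prod.fst_add, kz, zero_add] at k
    exact hy k

/-- `Ω` contains the unit balls of both factors, hence spans. -/
theorem Circled.linearMap_ext (h : Circled Ω) {G : Type*} [AddCommGroup G] [Module ℂ G]
    {f g : E × F →ₗ[ℂ] G} (hfg : ∀ p ∈ Ω, f p = g p) : f = g := by
  refine LinearMap.prod_ext ?_ ?_ <;> ext x <;> rcases eq_or_ne x 0 with rfl | hx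
  · simp [Prod.mk_zero_zero]
  · have := congrArg ((‖x‖ : ℂ) • ·) (hfg _ (h.left_mem _ (norm_inv_norm_smul hx).le))
    simp only [← map_smul, Prod.smul_mk, norm_smul_inv_norm_smul, smul_zero] at this
    simpa using this
  · simp [Prod.mk_zero_zero]
  · have := congrArg ((‖x‖ : ℂ) • ·) (hfg _ (h.right_mem _ (norm_inv_norm_smul hx).le))
    simp only [← map_smul, Prod.smul_mk, norm_smul_inv_norm_smul, smul_zero] at this
    simpa using this

theorem Biholo.norm_left (h : Biholo Ω Ω' θ θ' M M') (z : E) : ‖M (z, 0)‖ = ‖z‖ := by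
  rcases eq_or_ne z 0 with rfl | hz
  · rw [Prod.mk_zero_zero, map_zero, norm_zero, norm_zero]
  · have := congrArg (‖z‖ * ·)
      (h.norm_deriv (h.circled.left_mem _ (norm_inv_norm_smul hz).le))
    have e : M ((‖z‖ : ℂ)⁻¹ • z, 0) = (‖z‖ : ℂ)⁻¹ • M (z, 0) := by rw [← map_smul]; simp
    rw [e] at this
    simpa [norm_smul, Prod.norm_def, hz] using this

variable [CompleteSpace E] [CompleteSpace F] [CompleteSpace E'] [CompleteSpace F']

/-- A biholomorphic map between circled sets which fixes the origin is linear. -/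
theorem Biholo.eq_deriv (h : Biholo Ω Ω' θ θ' M M') {p : E × F} (hp : p ∈ Ω) : θ p = M p := by
  have key : ∀ p ∈ Ω, ‖p‖ < 1 → θ p = M p := by
    rintro ⟨z, w⟩ hp h1
    have hz : ‖z‖ < 1 := (norm_fst_le (z, w)).trans_lt h1
    have hw : ‖w‖ < 1 := (norm_snd_le (z, w)).trans_lt h1
    rcases eq_or_ne w 0 with rfl | hw0
    · exact h.left_eq hz
    rcases eq_or_ne z 0 with rfl | hz0
    · exact h.swap_domain.left_eq hw
    have hu : ((‖z‖ : ℂ)⁻¹ • z, (‖w‖ : ℂ)⁻¹ • w) ∈ Ω :=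
      h.circled.smul_mem _ hp _ _ (norm_inv_norm_smul hz0).le (norm_inv_norm_smul hw0).le
    have := h.eq_of_unit hu (norm_inv_norm_smul hz0) (norm_inv_norm_smul hw0)
      (s := (‖z‖ : ℂ)) (t := (‖w‖ : ℂ)) (by simpa using hz) (by simpa using hw)
    rwa [norm_smul_inv_norm_smul, norm_smul_inv_norm_smul] at this
  -- Points of norm 1 are reached by radial continuity.
  refine tendsto_nhds_unique (h.holo.tendsto p hp) ?_
  have hc : Tendsto (fun s : ℝ => (s : ℂ) • M p) (𝓝[<] 1) (𝓝 (M p)) := by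
    have : Continuous fun s : ℝ => (s : ℂ) • M p := by fun_prop
    simpa using (this.tendsto 1).mono_left nhdsWithin_le_nhds
  refine hc.congr' ?_
  filter_upwards [Ioo_mem_nhdsLT (zero_lt_one' ℝ)] with s hs
  have hns : ‖(s : ℂ)‖ < 1 := by simpa [abs_of_pos hs.1] using hs.2
  rw [← map_smul]
  refine (key _ (h.circled.smul_mem_of_norm_le_one hp hns.le hns.le) ?_).symm
  rw [← Prod.smul_def, norm_smul]
  exact mul_lt_one_of_nonneg_of_lt_one_left (norm_nonneg _) hns (h.circled.norm_le p hp)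

theorem Biholo.deriv_left_inv (h : Biholo Ω Ω' θ θ' M M') (p : E × F) : M' (M p) = p := by
  have : M' ∘ₗ M = LinearMap.id := h.circled.linearMap_ext fun p hp => by
    have hm := h.holo.mem p hp
    simp only [LinearMap.comp_apply, LinearMap.id_apply]
    rw [h.eq_deriv hp] at hm
    rw [← h.symm.eq_deriv hm, ← h.eq_deriv hp, h.left_inv p hp]
  exact LinearMap.congr_fun this p

theorem Biholo.exists_left (h : Biholo Ω Ω' θ θ' M M') (h1 : ∀ z, (M (z, 0)).2 = 0)
    (h2 : ∀ z, (M' (z, 0)).2 = 0) : ∃ U : E ≃ₗᵢ[ℂ] E', ∀ z, M (z, 0) = (U z, 0) := by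
  have e1 : ∀ z, M (z, 0) = ((M (z, 0)).1, 0) := fun z => Prod.ext rfl (h1 z)
  have e2 : ∀ z, M' (z, 0) = ((M' (z, 0)).1, 0) := fun z => Prod.ext rfl (h2 z)
  refine ⟨⟨LinearEquiv.ofLinearMap (LinearMap.fst ℂ E' F' ∘ₗ M ∘ₗ LinearMap.inl ℂ E F)
    (LinearMap.fst ℂ E F ∘ₗ M' ∘ₗ LinearMap.inl ℂ E' F') ?_ ?_, ?_⟩, fun z => e1 z⟩
  · ext z
    simp [← e2, h.symm.deriv_left_inv]
  · ext z
    simp [← e1, h.deriv_left_inv]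
  · intro z
    have := h.norm_left z
    rw [e1] at this
    simpa [Prod.norm_def] using this

/-- Excludes, for a nonzero factor, that `M` takes `E` into `E'` while `M'` takes `E'` into `F`,
since `M'` inverts `M`. -/
theorem Biholo.eq_zero_of_left (h : Biholo Ω Ω' θ θ' M M') (h1 : ∀ z, (M (z, 0)).2 = 0)
    (h2 : ∀ z, (M' (z, 0)).1 = 0) (z : E) : z = 0 := by
  have e1 : M (z, 0) = ((M (z, 0)).1, 0) := Prod.ext rfl (h1 z)
  have := h.deriv_left_inv (z, 0)
  rw [e1] at this
  exact (congrArg Prod.fst this).symm.trans (h2 _)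

/-- A biholomorphic map which fixes the origin maps the factors isometrically to factors. -/
theorem Biholo.exists_isometries (h : Biholo Ω Ω' θ θ' M M') :
    (∃ (U : E ≃ₗᵢ[ℂ] E') (V : F ≃ₗᵢ[ℂ] F'), ∀ p ∈ Ω, θ p = (U p.1, V p.2)) ∨
    (∃ (U : E ≃ₗᵢ[ℂ] F') (V : F ≃ₗᵢ[ℂ] E'), ∀ p ∈ Ω, θ p = (V p.2, U p.1)) := by
  have c1 := h.left_cases
  have c2 : (∀ w, (M (0, w)).2 = 0) ∨ (∀ w, (M (0, w)).1 = 0) := h.swap_domain.left_cases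
  have c3 := h.symm.left_cases
  have c4 : (∀ w, (M' (0, w)).2 = 0) ∨ (∀ w, (M' (0, w)).1 = 0) := h.symm.swap_domain.left_cases
  have a1 : (∀ z, (M (z, 0)).2 = 0) → (∀ z, (M' (z, 0)).1 = 0) → ∀ z : E, z = 0 :=
    h.eq_zero_of_left
  have a2 : (∀ z, (M (z, 0)).1 = 0) → (∀ z, (M' (0, z)).1 = 0) → ∀ z : E, z = 0 :=
    h.swap_codomain.eq_zero_of_left
  have a3 : (∀ w, (M (0, w)).2 = 0) → (∀ z, (M' (z, 0)).2 = 0) → ∀ w : F, w = 0 :=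
    h.swap_domain.eq_zero_of_left
  have a4 : (∀ w, (M (0, w)).1 = 0) → (∀ z, (M' (0, z)).2 = 0) → ∀ w : F, w = 0 :=
    h.swap_domain.swap_codomain.eq_zero_of_left
  have b1 : (∀ z, (M' (z, 0)).2 = 0) → (∀ z, (M (z, 0)).1 = 0) → ∀ z : E', z = 0 :=
    h.symm.eq_zero_of_left
  have b2 : (∀ z, (M' (z, 0)).1 = 0) → (∀ z, (M (0, z)).1 = 0) → ∀ z : E', z = 0 :=
    h.symm.swap_codomain.eq_zero_of_left
  have b3 : (∀ w, (M' (0, w)).2 = 0) → (∀ z, (M (z, 0)).2 = 0) → ∀ w : F', w = 0 :=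
    h.symm.swap_domain.eq_zero_of_left
  have b4 : (∀ w, (M' (0, w)).1 = 0) → (∀ z, (M (0, z)).2 = 0) → ∀ w : F', w = 0 :=
    h.symm.swap_domain.swap_codomain.eq_zero_of_left
  -- A zero factor satisfies both alternatives. With this, choosing consistent alternatives for the
  -- four factors is a purely propositional problem.
  have t1 : (∀ z : E, z = 0) → (∀ z, (M (z, 0)).2 = 0) ∧ (∀ z, (M (z, 0)).1 = 0) := fun h0 => by
    constructor <;> intro z <;> rw [h0 z, Prod.mk_zero_zero, map_zero] <;> rfl
  have t2 : (∀ z : F, z = 0) → (∀ z, (M (0, z)).2 = 0) ∧ (∀ z, (M (0, z)).1 = 0) := fun h0 => by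
    constructor <;> intro z <;> rw [h0 z, Prod.mk_zero_zero, map_zero] <;> rfl
  have t3 : (∀ z : E', z = 0) → (∀ z, (M' (z, 0)).2 = 0) ∧ (∀ z, (M' (z, 0)).1 = 0) :=
    fun h0 => by constructor <;> intro z <;> rw [h0 z, Prod.mk_zero_zero, map_zero] <;> rfl
  have t4 : (∀ z : F', z = 0) → (∀ z, (M' (0, z)).2 = 0) ∧ (∀ z, (M' (0, z)).1 = 0) :=
    fun h0 => by constructor <;> intro z <;> rw [h0 z, Prod.mk_zero_zero, map_zero] <;> rfl
  have hsum : ∀ z w, M (z, w) = M (z, 0) + M (0, w) := fun z w => by rw [← map_add]; simp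
  have key : ((∀ z, (M (z, 0)).2 = 0) ∧ (∀ w, (M (0, w)).1 = 0) ∧ (∀ z, (M' (z, 0)).2 = 0) ∧
      (∀ w, (M' (0, w)).1 = 0)) ∨
      ((∀ z, (M (z, 0)).1 = 0) ∧ (∀ w, (M (0, w)).2 = 0) ∧ (∀ z, (M' (z, 0)).1 = 0) ∧
      (∀ w, (M' (0, w)).2 = 0)) := by
    generalize (∀ z, (M (z, 0)).2 = 0) = p1 at *
    generalize (∀ z, (M (z, 0)).1 = 0) = p2 at *
    generalize (∀ z, (M (0, z)).2 = 0) = p3 at *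
    generalize (∀ z, (M (0, z)).1 = 0) = p4 at *
    generalize (∀ z, (M' (z, 0)).2 = 0) = p5 at *
    generalize (∀ z, (M' (z, 0)).1 = 0) = p6 at *
    generalize (∀ z, (M' (0, z)).2 = 0) = p7 at *
    generalize (∀ z, (M' (0, z)).1 = 0) = p8 at *
    generalize (∀ z : E, z = 0) = p9 at *
    generalize (∀ z : F, z = 0) = p10 at *
    generalize (∀ z : E', z = 0) = p11 at *
    generalize (∀ z : F', z = 0) = p12 at *
    grind
  rcases key with ⟨k1, k2, k3, k4⟩ | ⟨k1, k2, k3, k4⟩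
  · left
    obtain ⟨U, hU⟩ := h.exists_left k1 k3
    obtain ⟨V, hV⟩ := h.swap_domain.swap_codomain.exists_left k2 k4
    refine ⟨U, V, ?_⟩
    rintro ⟨z, w⟩ hp
    have hV' : M (0, w) = (0, V w) := Prod.swap_injective (hV w)
    rw [h.eq_deriv hp, hsum, hU, hV']
    simp
  · right
    obtain ⟨U, hU⟩ := h.swap_codomain.exists_left k1 k4
    obtain ⟨V, hV⟩ := h.swap_domain.exists_left k2 k3
    refine ⟨U, V, ?_⟩
    rintro ⟨z, w⟩ hp
    have hU' : M (z, 0) = (0, U z) := Prod.swap_injective (hU z)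
    have hV' : M (0, w) = (V w, 0) := hV w
    rw [h.eq_deriv hp, hsum, hU', hV']
    simp

end CircledHolo

/-! ### Commutation relations and norm estimates for the generators. -/

namespace UnitaryRelation

variable {n m n' m' : ℕ}

theorem hasSum_basisVec (x : Fock n m) : HasSum (fun a => x a • basisVec a) x := by
  have := lp.hasSum_single (E := fun _ : Word n m => ℂ) (p := 2) (by norm_num) x
  convert this using 2 with a
  rw [basisVec, ← lp.single_smul, smul_eq_mul, mul_one]

theorem clm_ext_basisVec {G : Type*} [NormedAddCommGroup G] [NormedSpace ℂ G]
    {f g : Fock n m →L[ℂ] G} (h : ∀ a, f (basisVec a) = g (basisVec a)) : f = g := by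
  ext x
  have h1 := (hasSum_basisVec x).mapL f
  have h2 := (hasSum_basisVec x).mapL g
  simp only [map_smul, h] at h1 h2
  exact h1.unique h2

theorem Le_basisVec (i : Fin n) (a : List (Fin n)) (b : List (Fin m)) :
    Le i (basisVec (a, b)) = basisVec (i :: a, b) :=
  isometryOf_basisVec _ _ _

theorem Lf_basisVec (u : UMat n m) (l : Fin m) (a : List (Fin n)) (b : List (Fin m)) :
    Lf u l (basisVec (a, b)) = fVec u l a b :=
  isometryOf_basisVec _ _ _

/-- On basis vectors this is the recursion defining `fVec`. Unitarity of `u` inverts it to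
`Le_Lf_apply`. -/
theorem Lf_Le_apply (u : UMat n m) (k : Fin n) (l : Fin m) (x : Fock n m) :
    Lf u l (Le k x) = ∑ p : Fin n × Fin m, conj (u.1 p (k, l)) • Le p.1 (Lf u p.2 x) := by
  have : Lf u l ∘L Le k = ∑ p : Fin n × Fin m, conj (u.1 p (k, l)) • (Le p.1 ∘L Lf u p.2) := by
    refine clm_ext_basisVec ?_
    rintro ⟨a, b⟩
    simp [Le_basisVec, Lf_basisVec, fVec]
  simpa [sum_apply] using congrArg (fun T => T x) this

theorem sum_mul_conj (u : UMat n m) (p q : Fin n × Fin m) :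
    ∑ r, u.1 p r * conj (u.1 q r) = if p = q then 1 else 0 := by
  have h := congrFun (congrFun (Matrix.mem_unitaryGroup_iff.1 u.2) p) q
  rw [Matrix.mul_apply, Matrix.one_apply] at h
  simpa [Matrix.star_apply] using h

theorem sum_conj_mul (u : UMat n m) (p q : Fin n × Fin m) :
    ∑ r, conj (u.1 r p) * u.1 r q = if p = q then 1 else 0 := by
  have h := congrFun (congrFun (Matrix.mem_unitaryGroup_iff'.1 u.2) p) q
  rw [Matrix.mul_apply, Matrix.one_apply] at h
  simpa [Matrix.star_apply] using h

theorem Le_Lf_apply (u : UMat n m) (i : Fin n) (j : Fin m) (x : Fock n m) :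
    Le i (Lf u j x) = ∑ q : Fin n × Fin m, u.1 (i, j) q • Lf u q.2 (Le q.1 x) := by
  simp only [Lf_Le_apply, Finset.smul_sum, smul_smul]
  rw [Finset.sum_comm]
  simp only [← Finset.sum_smul, Prod.mk.eta, sum_mul_conj]
  simp

theorem inner_Lf_Lf (u : UMat n m) (j j' : Fin m) (x y : Fock n m) :
    inner ℂ (Lf u j x) (Lf u j' y) = if j = j' then inner ℂ x y else (0 : ℂ) := by
  split_ifs with h
  · subst h
    exact (orthonormal_fVec u j).orthogonalFamily.linearIsometry.inner_map_map x y
  · refine inner_isometryOf_eq_zero _ _ _ _ fun c => ?_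
    rw [← inner_conj_symm, map_eq_zero]
    refine inner_isometryOf_eq_zero _ _ _ _ fun a => ?_
    simp [inner_fVec, Ne.symm h]

/-- Vectors without `F`-factors are orthogonal to the range of `L_{f_j}`. -/
theorem inner_basisVec_Lf (u : UMat n m) (a : List (Fin n)) (j : Fin m) (x : Fock n m) :
    inner ℂ (basisVec (a, [])) (Lf u j x) = (0 : ℂ) := by
  refine inner_isometryOf_eq_zero _ _ _ _ ?_
  rintro ⟨a', b⟩
  simp only
  induction a generalizing a' j with
  | nil =>
    cases a' with
    | nil => simp [fVec, inner_basisVec]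
    | cons k a' => simp [fVec, inner_basisVec_nil_Le]
  | cons i a ih =>
    cases a' with
    | nil => simp [fVec, inner_basisVec]
    | cons k a' =>
      simp [fVec, ← Le_basisVec, inner_Le_Le, ih]

/-- A linear combination of operators with orthogonal isometric ranges is a multiple of an
isometry. -/
theorem norm_sum_smul_le {H ι : Type*} [NormedAddCommGroup H] [InnerProductSpace ℂ H] [Fintype ι]
    [DecidableEq ι] (T : ι → H →L[ℂ] H)
    (hT : ∀ i j x y, inner ℂ (T i x) (T j y) = if i = j then inner ℂ x y else (0 : ℂ))
    (c : EuclideanSpace ℂ ι) : ‖∑ i, c i • T i‖ ≤ ‖c‖ := by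
  refine ContinuousLinearMap.opNorm_le_bound _ (norm_nonneg _) fun x => ?_
  refine (pow_le_pow_iff_left₀ (norm_nonneg _) (by positivity) two_ne_zero).1 ?_
  have h1 : (inner ℂ ((∑ i, c i • T i) x) ((∑ i, c i • T i) x) : ℂ)
      = (∑ i, (‖c i‖ : ℂ) ^ 2) * (‖x‖ : ℂ) ^ 2 := by
    simp only [sum_apply, smul_apply, sum_inner, inner_sum,
      inner_smul_left, inner_smul_right, hT]
    rw [Finset.sum_mul]
    refine Finset.sum_congr rfl fun i _ => ?_
    simp [← mul_assoc, Complex.mul_conj', inner_self_eq_norm_sq_to_K]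
  generalize (∑ i, c i • T i) x = y at h1 ⊢
  rw [inner_self_eq_norm_sq_to_K] at h1
  rw [mul_pow, EuclideanSpace.norm_sq_eq]
  refine le_of_eq (Complex.ofReal_injective ?_)
  push_cast
  exact h1

/-- The vacuum vector. -/
def vac (n m : ℕ) : Fock n m := basisVec ([], [])

@[simp]
theorem norm_vac : ‖vac n m‖ = 1 := by
  simp [vac, basisVec, lp.norm_single]

theorem inner_vac_vac : (inner ℂ (vac n m) (vac n m) : ℂ) = 1 := by
  simp

theorem inner_vac_Le (i : Fin n) (x : Fock n m) : inner ℂ (vac n m) (Le i x) = (0 : ℂ) :=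
  inner_basisVec_nil_Le _ _ _

theorem inner_vac_Lf (u : UMat n m) (j : Fin m) (x : Fock n m) :
    inner ℂ (vac n m) (Lf u j x) = (0 : ℂ) :=
  inner_basisVec_Lf _ _ _ _

instance (u : UMat n m) : CompleteSpace (Alg u) :=
  (Subalgebra.isClosed_topologicalClosure _).completeSpace_coe

theorem genE_mul_genF (u : UMat n m) (i : Fin n) (j : Fin m) :
    genE u i * genF u j = ∑ q : Fin n × Fin m, u.1 (i, j) q • (genF u q.2 * genE u q.1) := by
  refine Subtype.ext (ContinuousLinearMap.ext fun x => ?_)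
  simpa [genE, genF] using Le_Lf_apply u i j x

theorem genF_mul_genE (u : UMat n m) (l : Fin m) (k : Fin n) :
    genF u l * genE u k =
      ∑ p : Fin n × Fin m, conj (u.1 p (k, l)) • (genE u p.1 * genF u p.2) := by
  refine Subtype.ext (ContinuousLinearMap.ext fun x => ?_)
  simpa [genE, genF] using Lf_Le_apply u k l x

theorem norm_sum_smul_genE_le (u : UMat n m) (c : EuclideanSpace ℂ (Fin n)) :
    ‖∑ i, c i • genE u i‖ ≤ ‖c‖ := by
  have : ((∑ i, c i • genE u i : Alg u) : Fock n m →L[ℂ] Fock n m) = ∑ i, c i • Le i := by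
    simp [genE]
  change ‖((∑ i, c i • genE u i : Alg u) : Fock n m →L[ℂ] Fock n m)‖ ≤ ‖c‖
  rw [this]
  exact norm_sum_smul_le _ inner_Le_Le c

theorem norm_sum_smul_genF_le (u : UMat n m) (c : EuclideanSpace ℂ (Fin m)) :
    ‖∑ i, c i • genF u i‖ ≤ ‖c‖ := by
  have : ((∑ i, c i • genF u i : Alg u) : Fock n m →L[ℂ] Fock n m) = ∑ i, c i • Lf u i := by
    simp [genF]
  change ‖((∑ i, c i • genF u i : Alg u) : Fock n m →L[ℂ] Fock n m)‖ ≤ ‖c‖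
  rw [this]
  exact norm_sum_smul_le _ (inner_Lf_Lf u) c

theorem Alg.dense_adjoin (u : UMat n m) :
    Dense (Algebra.adjoin ℂ (range (genE u) ∪ range (genF u)) : Set (Alg u)) := by
  set S := Algebra.adjoin ℂ (Set.range (Le : Fin n → Fock n m →L[ℂ] Fock n m) ∪
    Set.range (Lf u)) with hS
  have hle : S ≤ S.topologicalClosure := Subalgebra.le_topologicalClosure _
  have hdense : DenseRange (Set.inclusion hle) := by
    rw [denseRange_inclusion_iff]
    · exact fun x hx => hx
    · exact hle
  refine hdense.mono ?_
  rintro _ ⟨⟨x, hx⟩, rfl⟩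
  change (⟨x, hle hx⟩ : Alg u) ∈ Algebra.adjoin ℂ (range (genE u) ∪ range (genF u))
  induction hx using Algebra.adjoin_induction with
  | mem x hx =>
    rcases hx with ⟨i, rfl⟩ | ⟨j, rfl⟩
    · exact Algebra.subset_adjoin (Or.inl ⟨i, rfl⟩)
    · exact Algebra.subset_adjoin (Or.inr ⟨j, rfl⟩)
  | algebraMap r => exact Subalgebra.algebraMap_mem _ r
  | add x y hx hy h1 h2 => exact add_mem h1 h2
  | mul x y hx hy h1 h2 => exact mul_mem h1 h2

theorem Alg.induction {u : UMat n m} {P : Alg u → Prop} (hc : IsClosed {X | P X})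
    (hE : ∀ i, P (genE u i)) (hF : ∀ j, P (genF u j)) (h1 : ∀ c, P (algebraMap ℂ (Alg u) c))
    (hadd : ∀ X Y, P X → P Y → P (X + Y)) (hmul : ∀ X Y, P X → P Y → P (X * Y)) (X : Alg u) :
    P X := by
  refine (Alg.dense_adjoin u).induction (P := P) (fun X hX => ?_) hc X
  induction hX using Algebra.adjoin_induction with
  | mem x hx =>
    rcases hx with ⟨i, rfl⟩ | ⟨j, rfl⟩
    · exact hE i
    · exact hF j
  | algebraMap r => exact h1 r
  | add x y hx hy h1 h2 => exact hadd _ _ h1 h2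
  | mul x y hx hy h1 h2 => exact hmul _ _ h1 h2

/-! ### Normal ordering of monomials. -/

section Monomials

variable {R ι κ : Type*} [Ring R] [Algebra ℂ R] (x : ι → R) (y : κ → R)

/-- The span of the monomials `x_α y_β` of total degree `N`. -/
def monomialSpan (N : ℕ) : Submodule ℂ R :=
  Submodule.span ℂ {X | ∃ (a : List ι) (b : List κ), a.length + b.length = N ∧
    X = (a.map x).prod * (b.map y).prod}

variable {x y}

theorem mul_monomialSpan_left {N : ℕ} (i : ι) {X : R} (hX : X ∈ monomialSpan x y N) :
    x i * X ∈ monomialSpan x y (N + 1) := by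
  induction hX using Submodule.span_induction with
  | mem X hX =>
    obtain ⟨a, b, h, rfl⟩ := hX
    exact Submodule.subset_span ⟨i :: a, b, by simp; omega, by simp [mul_assoc]⟩
  | zero => simp
  | add X Y _ _ h1 h2 => rw [mul_add]; exact add_mem h1 h2
  | smul c X _ h => rw [mul_smul_comm]; exact Submodule.smul_mem _ _ h

variable [Fintype ι] [Fintype κ]

/-- The relation moves `y j` past the letters of `a` one at a time; each move changes its index, so
the induction is over all `j`. -/
theorem mul_monomialSpan_right {c : ι × κ → ι × κ → ℂ}
    (hc : ∀ i j, y j * x i = ∑ p : ι × κ, c (i, j) p • (x p.1 * y p.2)) {N : ℕ} (j : κ) {X : R}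
    (hX : X ∈ monomialSpan x y N) : y j * X ∈ monomialSpan x y (N + 1) := by
  induction hX using Submodule.span_induction with
  | mem X hX =>
    obtain ⟨a, b, h, rfl⟩ := hX
    induction a generalizing j N with
    | nil => exact Submodule.subset_span ⟨[], j :: b, by simp at h ⊢; omega, by simp⟩
    | cons i a ih =>
      rw [List.map_cons, List.prod_cons, mul_assoc, ← mul_assoc, hc, Finset.sum_mul]
      refine Submodule.sum_mem _ fun p _ => ?_
      rw [smul_mul_assoc, mul_assoc]
      refine Submodule.smul_mem _ _ (mul_monomialSpan_left _ ?_)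
      have := ih (N := a.length + b.length) p.2 rfl
      simp only [List.length_cons] at h
      rwa [show N = a.length + b.length + 1 by omega]
  | zero => simp
  | add X Y _ _ h1 h2 => rw [mul_add]; exact add_mem h1 h2
  | smul c X _ h => rw [mul_smul_comm]; exact Submodule.smul_mem _ _ h

/-- If the `y_j x_i` are combinations of the `x_k y_l`, then the monomials `x_α y_β` span the
algebra generated by all `x_i` and `y_j`. -/
theorem adjoin_le_span_monomials {c : ι × κ → ι × κ → ℂ}
    (hc : ∀ i j, y j * x i = ∑ p : ι × κ, c (i, j) p • (x p.1 * y p.2)) {X : R}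
    (hX : X ∈ Algebra.adjoin ℂ (range x ∪ range y)) :
    X ∈ Submodule.span ℂ (range fun p : List ι × List κ => (p.1.map x).prod * (p.2.map y).prod) := by
  set S := Submodule.span ℂ
    (range fun p : List ι × List κ => (p.1.map x).prod * (p.2.map y).prod) with hS
  have hle : ∀ N, monomialSpan x y N ≤ S := fun N => Submodule.span_mono (by
    rintro _ ⟨a, b, -, rfl⟩
    exact ⟨(a, b), rfl⟩)
  have hgen : ∀ g ∈ range x ∪ range y, ∀ Y ∈ S, g * Y ∈ S := by
    intro g hg Y hY
    induction hY using Submodule.span_induction with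
    | mem Y hY =>
      obtain ⟨⟨a, b⟩, rfl⟩ := hY
      have hm : (a.map x).prod * (b.map y).prod ∈ monomialSpan x y (a.length + b.length) :=
        Submodule.subset_span ⟨a, b, rfl, rfl⟩
      rcases hg with ⟨i, rfl⟩ | ⟨j, rfl⟩
      · exact hle _ (mul_monomialSpan_left i hm)
      · exact hle _ (mul_monomialSpan_right hc j hm)
    | zero => simp
    | add X Y _ _ h1 h2 => rw [mul_add]; exact add_mem h1 h2
    | smul c X _ h => rw [mul_smul_comm]; exact Submodule.smul_mem _ _ h
  -- Stability of `S` under left multiplication passes to sums and products of generators; the claim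
  -- is the case `Y = 1`.
  have key : ∀ Y ∈ S, X * Y ∈ S := by
    induction hX using Algebra.adjoin_induction with
    | mem g hg => exact hgen g hg
    | algebraMap r =>
      intro Y hY
      rw [Algebra.algebraMap_eq_smul_one, smul_mul_assoc, one_mul]
      exact Submodule.smul_mem _ _ hY
    | add X Y _ _ h1 h2 => exact fun Z hZ => by rw [add_mul]; exact add_mem (h1 Z hZ) (h2 Z hZ)
    | mul X Y _ _ h1 h2 => exact fun Z hZ => by rw [mul_assoc]; exact h1 _ (h2 Z hZ)
  simpa using key 1 (Submodule.subset_span ⟨([], []), by simp⟩)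

end Monomials

/-- Closed linear conditions on `𝒜_u` can be checked on the monomials `L_{e_α} L_{f_β}`. -/
theorem Alg.induction_EF {u : UMat n m} {P : Alg u → Prop} (hc : IsClosed {X | P X})
    (hm : ∀ a b, P ((List.map (genE u) a).prod * (List.map (genF u) b).prod)) (h0 : P 0)
    (hadd : ∀ X Y, P X → P Y → P (X + Y)) (hsmul : ∀ (c : ℂ) X, P X → P (c • X)) (X : Alg u) :
    P X := by
  refine (Alg.dense_adjoin u).induction (P := P) (fun X hX => ?_) hc X
  replace hX := adjoin_le_span_monomials (c := fun q p => conj (u.1 p q))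
    (fun i j => genF_mul_genE u j i) hX
  induction hX using Submodule.span_induction with
  | mem X hX =>
    obtain ⟨⟨a, b⟩, rfl⟩ := hX
    exact hm a b
  | zero => exact h0
  | add X Y _ _ h1 h2 => exact hadd _ _ h1 h2
  | smul c X _ h => exact hsmul _ _ h

/-- Closed linear conditions on `𝒜_u` can be checked on the monomials `L_{f_β} L_{e_α}`. -/
theorem Alg.induction_FE {u : UMat n m} {P : Alg u → Prop} (hc : IsClosed {X | P X})
    (hm : ∀ b a, P ((List.map (genF u) b).prod * (List.map (genE u) a).prod)) (h0 : P 0)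
    (hadd : ∀ X Y, P X → P Y → P (X + Y)) (hsmul : ∀ (c : ℂ) X, P X → P (c • X)) (X : Alg u) :
    P X := by
  refine (Alg.dense_adjoin u).induction (P := P) (fun X hX => ?_) hc X
  rw [SetLike.mem_coe, union_comm (range (genE u))] at hX
  replace hX := adjoin_le_span_monomials (x := genF u) (y := genE u)
    (c := fun q p => u.1 q.swap p.swap) (fun i j => by
      rw [genE_mul_genF]
      exact Fintype.sum_equiv (Equiv.prodComm _ _) _ _ fun q => rfl) hX
  induction hX using Submodule.span_induction with
  | mem X hX =>
    obtain ⟨⟨b, a⟩, rfl⟩ := hX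
    exact hm b a
  | zero => exact h0
  | add X Y _ _ h1 h2 => exact hadd _ _ h1 h2
  | smul c X _ h => exact hsmul _ _ h

/-! ### Characters of the algebra and points of `Omega u`. -/

theorem norm_algHom_apply_le {A : Type*} [NormedRing A] [NormedAlgebra ℂ A] [CompleteSpace A]
    (h1 : ‖(1 : A)‖ ≤ 1) (φ : A →ₐ[ℂ] ℂ) (X : A) : ‖φ X‖ ≤ ‖X‖ :=
  (AlgHom.norm_apply_le_self_mul_norm_one φ X).trans
    (mul_le_of_le_one_right (norm_nonneg _) h1)

theorem norm_char_le {u : UMat n m} (φ : Alg u →ₐ[ℂ] ℂ) (X : Alg u) : ‖φ X‖ ≤ ‖X‖ := by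
  refine norm_algHom_apply_le ?_ φ X
  change ‖ContinuousLinearMap.id ℂ (Fock n m)‖ ≤ 1
  exact ContinuousLinearMap.norm_id_le

theorem le_one_of_sq_le_self {x : ℝ} (h : x ^ 2 ≤ x) : x ≤ 1 := by
  by_contra! h1
  nlinarith

/-- Testing with the coefficients `conj (z i)`, where `z i = φ (T i)`, gives `‖z‖ ^ 2 ≤ ‖z‖`. -/
theorem norm_le_one_of_norm_sum_le {ι A : Type*} [Fintype ι] [NormedRing A] [NormedAlgebra ℂ A]
    (φ : A →ₐ[ℂ] ℂ) (hφ : ∀ X, ‖φ X‖ ≤ ‖X‖) (T : ι → A)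
    (hT : ∀ c : EuclideanSpace ℂ ι, ‖∑ i, c i • T i‖ ≤ ‖c‖) :
    ‖(WithLp.toLp 2 fun i => φ (T i) : EuclideanSpace ℂ ι)‖ ≤ 1 := by
  set z : EuclideanSpace ℂ ι := WithLp.toLp 2 fun i => φ (T i) with hz
  set c : EuclideanSpace ℂ ι := WithLp.toLp 2 fun i => conj (z i) with hc
  have h1 : ‖c‖ = ‖z‖ := by simp [EuclideanSpace.norm_eq, hc]
  have h2 : φ (∑ i, c i • T i) = ((‖z‖ ^ 2 : ℝ) : ℂ) := by
    rw [EuclideanSpace.norm_sq_eq, map_sum]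
    push_cast
    refine Finset.sum_congr rfl fun i _ => ?_
    simp [hc, hz, Complex.conj_mul']
  have h3 := (hφ (∑ i, c i • T i)).trans (hT c)
  rw [h2, h1, Complex.norm_real, Real.norm_of_nonneg (by positivity)] at h3
  exact le_one_of_sq_le_self h3

theorem charPoint_mem_Omega (u : UMat n m) (φ : Alg u →ₐ[ℂ] ℂ) : charPoint u φ ∈ Omega u := by
  refine ⟨fun i j => ?_, ?_, ?_⟩
  · have := congrArg φ (genE_mul_genF u i j)
    simp only [map_mul, map_sum, map_smul, smul_eq_mul] at this
    refine this.trans (Finset.sum_congr rfl fun q _ => ?_)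
    rw [mul_comm (φ (genF u q.2))]
    rfl
  · exact norm_le_one_of_norm_sum_le φ (norm_char_le φ) _ (norm_sum_smul_genE_le u)
  · exact norm_le_one_of_norm_sum_le φ (norm_char_le φ) _ (norm_sum_smul_genF_le u)

/-- A joint eigenvector `ν` of the adjoints of the generators gives a character. -/
theorem exists_char_of_eigenvector (u : UMat n m) (ν : Fock n m) (p : Pt n m)
    (h1 : inner ℂ ν (vac n m) = (1 : ℂ))
    (hE : ∀ i x, inner ℂ ν (Le i x) = p.1 i * (inner ℂ ν x : ℂ))
    (hF : ∀ j x, inner ℂ ν (Lf u j x) = p.2 j * (inner ℂ ν x : ℂ)) :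
    ∃ φ : Alg u →ₐ[ℂ] ℂ, charPoint u φ = p ∧
      ∀ X x, inner ℂ ν (X.1 x) = φ X * (inner ℂ ν x : ℂ) := by
  have key : ∀ X : Alg u, ∀ x,
      inner ℂ ν (X.1 x) = (inner ℂ ν (X.1 (vac n m)) : ℂ) * (inner ℂ ν x : ℂ) := by
    intro X
    induction X using Alg.induction with
    | hc =>
      simp only [ofPred_forall]
      refine isClosed_iInter fun x => isClosed_eq ?_ ?_ <;> fun_prop
    | hE i => intro x; simp [genE, hE, h1]
    | hF i => intro x; simp [genF, hF, h1]
    | h1 c =>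
      intro x
      simp [Algebra.algebraMap_eq_smul_one, h1]
    | hadd X Y hX hY =>
      intro x
      have e : ∀ x, (X + Y).1 x = X.1 x + Y.1 x := fun x => rfl
      rw [e, e, inner_add_right, inner_add_right, hX, hY, add_mul]
    | hmul X Y hX hY =>
      intro x
      have e : ∀ x, (X * Y).1 x = X.1 (Y.1 x) := fun x => rfl
      rw [e, e, hX, hY, hX (Y.1 _), mul_assoc]
  refine ⟨AlgHom.ofLinearMap
    ⟨⟨fun X => inner ℂ ν (X.1 (vac n m)), fun X Y => ?_⟩, fun c X => ?_⟩ ?_ ?_, ?_, key⟩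
  · exact inner_add_right _ _ _
  · exact inner_smul_right _ _ _
  · exact h1
  · intro X Y
    exact key X _
  · refine Prod.ext ?_ ?_
    · ext i
      change inner ℂ ν (Le i (vac n m)) = p.1 i
      rw [hE, h1, mul_one]
    · ext i
      change inner ℂ ν (Lf u i (vac n m)) = p.2 i
      rw [hF, h1, mul_one]

/-- The words of length `k` contribute `(∑ i, r i) ^ k`, a geometric series. -/
theorem summable_list_prod {ι : Type*} [Fintype ι] (r : ι → ℝ) (h0 : ∀ i, 0 ≤ r i)
    (h1 : ∑ i, r i < 1) : Summable fun a : List ι => (a.map r).prod := by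
  rw [← List.equivSigmaTuple.symm.summable_iff]
  have hp : ∀ k (f : Fin k → ι), ((List.equivSigmaTuple.symm ⟨k, f⟩).map r).prod = ∏ i, r (f i) := by
    intro k f
    simp [List.equivSigmaTuple, List.map_ofFn, List.prod_ofFn]
  rw [summable_sigma_of_nonneg]
  · refine ⟨fun k => Summable.of_finite, ?_⟩
    have h2 : 0 ≤ ∑ i, r i := Finset.sum_nonneg fun i _ => h0 i
    refine (summable_geometric_of_lt_one h2 h1).congr fun k => ?_
    rw [tsum_fintype, Fintype.sum_pow]
    exact (Finset.sum_congr rfl fun f _ => hp k f).symm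
  · rintro ⟨k, f⟩
    simp only [Function.comp_apply]
    rw [hp]
    exact Finset.prod_nonneg fun i _ => h0 _

/-- The value `z^α w^β`. -/
def wordValue (p : Pt n m) (a : Word n m) : ℂ := (a.1.map p.1).prod * (a.2.map p.2).prod

theorem memlp_wordValue {p : Pt n m} (hz : ‖p.1‖ < 1) (hw : ‖p.2‖ < 1) :
    Memℓp (E := fun _ : Word n m => ℂ) (fun a => conj (wordValue p a)) 2 := by
  have hs : ∀ {k : ℕ} (z : EuclideanSpace ℂ (Fin k)), ‖z‖ < 1 →
      Summable fun a : List (Fin k) => ‖(a.map z).prod‖ ^ 2 := by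
    intro k z hz
    have := summable_list_prod (fun i => ‖z i‖ ^ 2) (fun i => by positivity) (by
      rw [← EuclideanSpace.norm_sq_eq]
      exact pow_lt_one₀ (norm_nonneg _) hz two_ne_zero)
    refine this.congr fun a => ?_
    induction a with
    | nil => simp
    | cons i a ih => simp [mul_pow, ih]
  refine memℓp_gen ?_
  have := (hs p.1 hz).mul_of_nonneg (hs p.2 hw) (fun _ => by positivity) (fun _ => by positivity)
  refine this.congr fun a => ?_
  simp [wordValue, mul_pow]

theorem sum_conj_mul_eq_of_mem_variety {u : UMat n m} {p : Pt n m} (hp : p ∈ variety u)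
    (k : Fin n) (l : Fin m) :
    ∑ q : Fin n × Fin m, conj (u.1 q (k, l)) * (p.1 q.1 * p.2 q.2) = p.1 k * p.2 l := by
  have h : ∀ q : Fin n × Fin m, p.1 q.1 * p.2 q.2 =
      ∑ r : Fin n × Fin m, u.1 q r * (p.1 r.1 * p.2 r.2) := fun q => hp q.1 q.2
  rw [Finset.sum_congr rfl fun q _ => by rw [h q]]
  simp only [Finset.mul_sum, ← mul_assoc]
  rw [Finset.sum_comm]
  simp only [← Finset.sum_mul, sum_conj_mul]
  simp

/-- The eigenvector is the kernel vector with coefficients `conj (z^α w^β)`, square summable as both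
norms are below 1. For `Le` the eigenvalue equation is immediate; for `Lf` it is the equation of the
variety, used once for every letter of `α` that `f_l` passes. -/
theorem exists_char_of_norm_lt_one {u : UMat n m} {p : Pt n m} (hp : p ∈ variety u)
    (hz : ‖p.1‖ < 1) (hw : ‖p.2‖ < 1) : ∃ φ : Alg u →ₐ[ℂ] ℂ, charPoint u φ = p := by
  set ν : Fock n m := ⟨fun a => conj (wordValue p a), memlp_wordValue hz hw⟩ with hν
  have hb : ∀ a, (inner ℂ ν (basisVec a) : ℂ) = wordValue p a := by
    intro a
    rw [← inner_conj_symm, basisVec, lp.inner_single_left]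
    simp [hν]
  have hE : ∀ i x, inner ℂ ν (Le i x) = p.1 i * (inner ℂ ν x : ℂ) := by
    intro i x
    have : (innerSL ℂ ν) ∘L Le i = p.1 i • innerSL ℂ ν := clm_ext_basisVec fun ⟨a, b⟩ => by
      simp [Le_basisVec, hb, wordValue, mul_assoc]
    simpa using congrArg (fun T => T x) this
  have hV : ∀ l a b, (inner ℂ ν (fVec u l a b) : ℂ) = p.2 l * wordValue p (a, b) := by
    intro l a b
    induction a generalizing l with
    | nil => simp [fVec, hb, wordValue]
    | cons k a ih =>
      have : ∀ q : Fin n × Fin m, conj (u.1 q (k, l)) * (p.1 q.1 * (p.2 q.2 * wordValue p (a, b)))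
          = conj (u.1 q (k, l)) * (p.1 q.1 * p.2 q.2) * wordValue p (a, b) := fun q => by ring
      simp only [fVec, inner_sum, inner_smul_right, hE, ih, this]
      rw [← Finset.sum_mul, sum_conj_mul_eq_of_mem_variety hp]
      simp only [wordValue, List.map_cons, List.prod_cons]
      ring
  have hF : ∀ j x, inner ℂ ν (Lf u j x) = p.2 j * (inner ℂ ν x : ℂ) := by
    intro j x
    have : (innerSL ℂ ν) ∘L Lf u j = p.2 j • innerSL ℂ ν := clm_ext_basisVec fun ⟨a, b⟩ => by
      simp [Lf_basisVec, hb, hV]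
    simpa using congrArg (fun T => T x) this
  obtain ⟨φ, hφ, -⟩ := exists_char_of_eigenvector u ν p (by simp [vac, hb, wordValue]) hE hF
  exact ⟨φ, hφ⟩

/-- The character space is weak-* compact and the coordinates are evaluations. This yields the
characters at boundary points of `Omega u` as limits of interior ones. -/
theorem isClosed_range_charPoint (u : UMat n m) : IsClosed (range (charPoint u)) := by
  have hr : range (charPoint u) = range fun φ : WeakDual.characterSpace ℂ (Alg u) =>
      charPoint u (WeakDual.CharacterSpace.equivAlgHom φ) :=
    ((WeakDual.CharacterSpace.equivAlgHom (𝕜 := ℂ) (A := Alg u)).surjective.range_comp _).symm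
  rw [hr]
  refine (isCompact_range ?_).isClosed
  have h : ∀ X : Alg u, Continuous fun φ : WeakDual.characterSpace ℂ (Alg u) => φ X := fun X =>
    (WeakDual.eval_continuous X).comp continuous_subtype_val
  refine Continuous.prodMk ?_ ?_
  · exact (PiLp.continuous_toLp 2 _).comp (continuous_pi fun i => h _)
  · exact (PiLp.continuous_toLp 2 _).comp (continuous_pi fun i => h _)

theorem smul_mem_variety {u : UMat n m} {p : Pt n m} (hp : p ∈ variety u) (s t : ℂ) :
    (s • p.1, t • p.2) ∈ variety u := by
  intro i j
  have := congrArg (s * t * ·) (hp i j)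
  simp only [Finset.mul_sum, PiLp.smul_apply, smul_eq_mul] at this ⊢
  rw [show s * p.1 i * (t * p.2 j) = s * t * (p.1 i * p.2 j) by ring, this]
  exact Finset.sum_congr rfl fun q _ => by ring

theorem exists_char {u : UMat n m} {p : Pt n m} (hp : p ∈ Omega u) :
    ∃ φ : Alg u →ₐ[ℂ] ℂ, charPoint u φ = p := by
  have hcont : Continuous fun s : ℝ => (((s : ℂ) • p.1, (s : ℂ) • p.2) : Pt n m) := by fun_prop
  have ht : Tendsto (fun s : ℝ => (((s : ℂ) • p.1, (s : ℂ) • p.2) : Pt n m)) (𝓝[<] 1) (𝓝 p) := by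
    simpa using (hcont.tendsto 1).mono_left nhdsWithin_le_nhds
  refine (isClosed_range_charPoint u).mem_of_tendsto ht ?_
  filter_upwards [Ioo_mem_nhdsLT (zero_lt_one' ℝ)] with s hs
  have hns : ‖(s : ℂ)‖ < 1 := by simpa [abs_of_pos hs.1] using hs.2
  refine exists_char_of_norm_lt_one (smul_mem_variety hp.1 _ _) ?_ ?_ <;>
  · rw [norm_smul]
    first
    | exact mul_lt_one_of_nonneg_of_lt_one_left (norm_nonneg _) hns hp.2.1
    | exact mul_lt_one_of_nonneg_of_lt_one_left (norm_nonneg _) hns hp.2.2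

theorem circled_Omega (u : UMat n m) : CircledHolo.Circled (Omega u) where
  norm_le p hp := by
    rw [Prod.norm_def]
    exact max_le hp.2.1 hp.2.2
  smul_mem p hp s t hs ht := ⟨smul_mem_variety hp.1 s t, hs, ht⟩
  left_mem z hz := ⟨fun i j => by simp, hz, by simp⟩
  right_mem w hw := ⟨fun i j => by simp, by simp, hw⟩

/-! ### Holomorphic families of characters. -/

/-- A family of functions on `𝒜_u`, indexed by `K`, which consists of characters. -/
def IsCharFamily {u : UMat n m} (Φ : ℂ → Alg u → ℂ) (K : Set ℂ) : Prop :=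
  ∀ σ ∈ K, ∃ φ : Alg u →ₐ[ℂ] ℂ, Φ σ = φ

namespace IsCharFamily

variable {u : UMat n m} {Φ : ℂ → Alg u → ℂ} {K : Set ℂ}

theorem map_add (h : IsCharFamily Φ K) {σ : ℂ} (hσ : σ ∈ K) (X Y : Alg u) :
    Φ σ (X + Y) = Φ σ X + Φ σ Y := by
  obtain ⟨φ, hφ⟩ := h σ hσ
  rw [hφ, _root_.map_add]

theorem map_mul (h : IsCharFamily Φ K) {σ : ℂ} (hσ : σ ∈ K) (X Y : Alg u) :
    Φ σ (X * Y) = Φ σ X * Φ σ Y := by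
  obtain ⟨φ, hφ⟩ := h σ hσ
  rw [hφ, _root_.map_mul]

theorem map_algebraMap (h : IsCharFamily Φ K) {σ : ℂ} (hσ : σ ∈ K) (c : ℂ) :
    Φ σ (algebraMap ℂ (Alg u) c) = c := by
  obtain ⟨φ, hφ⟩ := h σ hσ
  rw [hφ]
  exact φ.commutes c

/-- Characters are contractive, so norm convergence in the algebra is uniform in the parameter.
Regularity in `σ` is therefore a closed condition on `X`, as `Alg.induction` requires. -/
theorem tendstoUniformlyOn (h : IsCharFamily Φ K) {x : ℕ → Alg u} {X : Alg u}
    (hx : Tendsto x atTop (𝓝 X)) :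
    TendstoUniformlyOn (fun k σ => Φ σ (x k)) (fun σ => Φ σ X) atTop K := by
  rw [Metric.tendstoUniformlyOn_iff]
  intro ε hε
  filter_upwards [Metric.tendsto_nhds.1 hx ε hε] with k hk σ hσ
  obtain ⟨φ, hφ⟩ := h σ hσ
  rw [dist_eq_norm] at hk
  rw [dist_comm, dist_eq_norm, hφ, ← map_sub]
  exact (norm_char_le φ _).trans_lt hk

theorem differentiableOn (h : IsCharFamily Φ K) (hK : IsOpen K)
    (hE : ∀ i, DifferentiableOn ℂ (fun σ => Φ σ (genE u i)) K)
    (hF : ∀ j, DifferentiableOn ℂ (fun σ => Φ σ (genF u j)) K) (X : Alg u) :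
    DifferentiableOn ℂ (fun σ => Φ σ X) K := by
  induction X using Alg.induction with
  | hc =>
    refine IsSeqClosed.isClosed fun x X hx hX => ?_
    exact (h.tendstoUniformlyOn hX).tendstoLocallyUniformlyOn.differentiableOn
      (Eventually.of_forall hx) hK
  | hE i => exact hE i
  | hF j => exact hF j
  | h1 c => exact (differentiableOn_const c).congr fun σ hσ => h.map_algebraMap hσ c
  | hadd X Y hX hY => exact (hX.add hY).congr fun σ hσ => h.map_add hσ X Y
  | hmul X Y hX hY => exact (hX.mul hY).congr fun σ hσ => h.map_mul hσ X Y

theorem continuousOn (h : IsCharFamily Φ K)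
    (hE : ∀ i, ContinuousOn (fun σ => Φ σ (genE u i)) K)
    (hF : ∀ j, ContinuousOn (fun σ => Φ σ (genF u j)) K) (X : Alg u) :
    ContinuousOn (fun σ => Φ σ X) K := by
  induction X using Alg.induction with
  | hc =>
    refine IsSeqClosed.isClosed fun x X hx hX => ?_
    exact (h.tendstoUniformlyOn hX).continuousOn (Frequently.of_forall hx)
  | hE i => exact hE i
  | hF j => exact hF j
  | h1 c => exact continuousOn_const.congr fun σ hσ => h.map_algebraMap hσ c
  | hadd X Y hX hY => exact (hX.add hY).congr fun σ hσ => h.map_add hσ X Y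
  | hmul X Y hX hY => exact (hX.mul hY).congr fun σ hσ => h.map_mul hσ X Y

/-- The derivative of a holomorphic family of characters is determined by its values on the
generators, as a point derivation. -/
theorem hasDerivAt (h : IsCharFamily Φ K) (hK : IsOpen K) {c : ℂ} (hc : c ∈ K)
    (hd : ∀ X, DifferentiableOn ℂ (fun σ => Φ σ X) K) (D : Alg u → ℂ) (hD : Continuous D)
    (hD1 : ∀ r, D (algebraMap ℂ (Alg u) r) = 0) (hDadd : ∀ X Y, D (X + Y) = D X + D Y)
    (hDmul : ∀ X Y, D (X * Y) = D X * Φ c Y + Φ c X * D Y)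
    (hE : ∀ i, HasDerivAt (fun σ => Φ σ (genE u i)) (D (genE u i)) c)
    (hF : ∀ j, HasDerivAt (fun σ => Φ σ (genF u j)) (D (genF u j)) c) (X : Alg u) :
    HasDerivAt (fun σ => Φ σ X) (D X) c := by
  have hev : ∀ᶠ σ in 𝓝 c, σ ∈ K := hK.mem_nhds hc
  induction X using Alg.induction with
  | hc =>
    refine IsSeqClosed.isClosed fun x X hx hX => ?_
    -- Weierstrass: locally uniform limits of holomorphic functions may be differentiated termwise.
    have h1 := ((h.tendstoUniformlyOn hX).tendstoLocallyUniformlyOn.deriv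
      (Eventually.of_forall fun k => hd (x k)) hK).tendsto_at hc
    have h2 : Tendsto (fun k => D (x k)) atTop (𝓝 (D X)) := (hD.tendsto X).comp hX
    have h3 : deriv (fun σ => Φ σ X) c = D X :=
      tendsto_nhds_unique h1 (h2.congr fun k => (hx k).deriv.symm)
    rw [mem_ofPred_eq, ← h3]
    exact ((hd X).differentiableAt (hK.mem_nhds hc)).hasDerivAt
  | hE i => exact hE i
  | hF j => exact hF j
  | h1 r =>
    rw [hD1]
    exact (hasDerivAt_const c r).congr_of_eventuallyEq
      (hev.mono fun σ hσ => h.map_algebraMap hσ r)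
  | hadd X Y hX hY =>
    rw [hDadd]
    exact (hX.add hY).congr_of_eventuallyEq (hev.mono fun σ hσ => h.map_add hσ X Y)
  | hmul X Y hX hY =>
    rw [hDmul]
    exact (hX.mul hY).congr_of_eventuallyEq (hev.mono fun σ hσ => h.map_mul hσ X Y)

end IsCharFamily

open Classical in
/-- The character at the point `p` (zero if there is none). -/
def chr (u : UMat n m) (p : Pt n m) : Alg u → ℂ :=
  if h : ∃ φ : Alg u →ₐ[ℂ] ℂ, charPoint u φ = p then h.choose else 0

theorem chr_charPoint (u : UMat n m) (φ : Alg u →ₐ[ℂ] ℂ) : chr u (charPoint u φ) = φ := by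
  have h : ∃ ψ : Alg u →ₐ[ℂ] ℂ, charPoint u ψ = charPoint u φ := ⟨φ, rfl⟩
  rw [chr, dif_pos h, charPoint_injective u h.choose_spec]

theorem chr_genE {u : UMat n m} {p : Pt n m} (hp : p ∈ Omega u) (i : Fin n) :
    chr u p (genE u i) = p.1 i := by
  obtain ⟨φ, rfl⟩ := exists_char hp
  rw [chr_charPoint]
  rfl

theorem chr_genF {u : UMat n m} {p : Pt n m} (hp : p ∈ Omega u) (j : Fin m) :
    chr u p (genF u j) = p.2 j := by
  obtain ⟨φ, rfl⟩ := exists_char hp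
  rw [chr_charPoint]
  rfl

theorem isCharFamily_chr {u : UMat n m} {K : Set ℂ} {p : ℂ → Pt n m}
    (hp : ∀ σ ∈ K, p σ ∈ Omega u) : IsCharFamily (fun σ => chr u (p σ)) K := by
  intro σ hσ
  obtain ⟨φ, hφ⟩ := exists_char (hp σ hσ)
  exact ⟨φ, by simp only [← hφ, chr_charPoint]⟩

theorem sliceHolo_chr {u : UMat n m} {p : Pt n m} (hp : p ∈ Omega u) (X : Alg u) :
    CircledHolo.SliceHolo fun s t => chr u (s • p.1, t • p.2) X := by
  intro U hU g₁ g₂ h₁ h₂ h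
  have hm : ∀ σ ∈ U, ((g₁ σ • p.1, g₂ σ • p.2) : Pt n m) ∈ Omega u := fun σ hσ =>
    (circled_Omega u).smul_mem_of_norm_le_one hp (h σ hσ).1.le (h σ hσ).2.le
  refine (isCharFamily_chr hm).differentiableOn hU (fun i => ?_) (fun j => ?_) X
  · exact (h₁.mul_const (p.1 i)).congr fun σ hσ => chr_genE (hm σ hσ) i
  · exact (h₂.mul_const (p.2 j)).congr fun σ hσ => chr_genF (hm σ hσ) j

theorem tendsto_chr {u : UMat n m} {p : Pt n m} (hp : p ∈ Omega u) (X : Alg u) :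
    Tendsto (fun s : ℝ => chr u ((s : ℂ) • p) X) (𝓝[<] 1) (𝓝 (chr u p X)) := by
  have hm : ∀ σ ∈ closedBall (0 : ℂ) 1, σ • p ∈ Omega u := fun σ hσ =>
    (circled_Omega u).smul_mem_of_norm_le_one hp (mem_closedBall_zero_iff.1 hσ)
      (mem_closedBall_zero_iff.1 hσ)
  have hc : ContinuousOn (fun σ : ℂ => chr u (σ • p) X) (closedBall 0 1) := by
    refine (isCharFamily_chr hm).continuousOn (fun i => ?_) (fun j => ?_) X
    · exact (continuousOn_id.mul continuousOn_const).congr fun σ hσ => chr_genE (hm σ hσ) i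
    · exact (continuousOn_id.mul continuousOn_const).congr fun σ hσ => chr_genF (hm σ hσ) j
  have h1 := hc 1 (by simp)
  rw [ContinuousWithinAt, one_smul] at h1
  refine h1.comp (tendsto_nhdsWithin_iff.2 ⟨?_, ?_⟩)
  · exact (Complex.continuous_ofReal.tendsto' 1 1 (by simp)).mono_left nhdsWithin_le_nhds
  · filter_upwards [Ioo_mem_nhdsLT (zero_lt_one' ℝ)] with s hs
    simpa [abs_of_pos hs.1] using hs.2.le

/-! ### First-order behaviour at the origin. -/

/-- The character at the origin is the vacuum functional. -/
theorem inner_vac_apply (u : UMat n m) (X : Alg u) (x : Fock n m) :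
    inner ℂ (vac n m) (X.1 x) = chr u 0 X * (inner ℂ (vac n m) x : ℂ) := by
  obtain ⟨φ, h1, h2⟩ := exists_char_of_eigenvector u (vac n m) 0 inner_vac_vac
    (fun i x => by simp [inner_vac_Le]) (fun j x => by simp [inner_vac_Lf])
  rw [h2, ← h1, chr_charPoint]

/-- The coefficients of degree one form point derivations at the origin. -/
theorem inner_degree_one_apply (u : UMat n m) (e : Fock n m)
    (hE : ∀ i x, (inner ℂ e (Le i x) : ℂ) =
      inner ℂ e (Le i (vac n m)) * inner ℂ (vac n m) x)
    (hF : ∀ j x, (inner ℂ e (Lf u j x) : ℂ) =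
      inner ℂ e (Lf u j (vac n m)) * inner ℂ (vac n m) x)
    (h0 : (inner ℂ e (vac n m) : ℂ) = 0) (X : Alg u) (x : Fock n m) :
    (inner ℂ e (X.1 x) : ℂ) =
      chr u 0 X * inner ℂ e x + inner ℂ e (X.1 (vac n m)) * inner ℂ (vac n m) x := by
  have hm : (0 : Pt n m) ∈ Omega u := (circled_Omega u).left_mem 0 (by simp)
  have hchr : ∀ X : Alg u, chr u 0 X = inner ℂ (vac n m) (X.1 (vac n m)) := fun X => by
    rw [inner_vac_apply, inner_vac_vac, mul_one]
  induction X using Alg.induction generalizing x with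
  | hc =>
    simp only [hchr, ofPred_forall]
    refine isClosed_iInter fun x => isClosed_eq ?_ ?_ <;> fun_prop
  | hE i =>
    rw [chr_genE hm]
    simp [genE, hE i x]
  | hF j =>
    rw [chr_genF hm]
    simp [genF, hF j x]
  | h1 c =>
    rw [hchr]
    simp [Algebra.algebraMap_eq_smul_one, h0]
  | hadd X Y hX hY =>
    have e : ∀ x, (X + Y).1 x = X.1 x + Y.1 x := fun x => rfl
    simp only [hchr, e, inner_add_right] at hX hY ⊢
    rw [hX, hY]
    ring
  | hmul X Y hX hY =>
    have e : ∀ x, (X * Y).1 x = X.1 (Y.1 x) := fun x => rfl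
    rw [e, hX, hY, e, hX (Y.1 (vac n m)), inner_vac_apply, hchr (X * Y), e, inner_vac_apply,
      inner_vac_apply, inner_vac_vac]
    ring

/-- The first order part at the origin of the Gelfand transform of an element of `𝒜_u`. -/
def linPart (u : UMat n m) (X : Alg u) : Pt n m →ₗ[ℂ] ℂ where
  toFun p := ∑ i, p.1 i * inner ℂ (basisVec ([i], [])) (X.1 (vac n m)) +
    ∑ j, p.2 j * inner ℂ (basisVec ([], [j])) (X.1 (vac n m))
  map_add' p q := by
    simp only [Prod.fst_add, Prod.snd_add, PiLp.add_apply, add_mul, Finset.sum_add_distrib]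
    ring
  map_smul' c p := by
    simp [Finset.mul_sum, mul_add, mul_assoc]

theorem linPart_apply (u : UMat n m) (X : Alg u) (p : Pt n m) : linPart u X p =
    ∑ i, p.1 i * inner ℂ (basisVec ([i], [])) (X.1 (vac n m)) +
    ∑ j, p.2 j * inner ℂ (basisVec ([], [j])) (X.1 (vac n m)) := rfl

theorem basisVec_singleton_E (i : Fin n) : (basisVec ([i], []) : Fock n m) = Le i (vac n m) :=
  (Le_basisVec _ _ _).symm

theorem basisVec_singleton_F (u : UMat n m) (j : Fin m) :
    (basisVec ([], [j]) : Fock n m) = Lf u j (vac n m) := by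
  rw [vac, Lf_basisVec, fVec]

theorem inner_E_apply (u : UMat n m) (i : Fin n) (X : Alg u) (x : Fock n m) :
    (inner ℂ (basisVec ([i], [])) (X.1 x) : ℂ) = chr u 0 X * inner ℂ (basisVec ([i], [])) x +
      inner ℂ (basisVec ([i], [])) (X.1 (vac n m)) * inner ℂ (vac n m) x := by
  refine inner_degree_one_apply u _ (fun k x => ?_) (fun j x => ?_) ?_ X x
  · rw [basisVec_singleton_E, inner_Le_Le, inner_Le_Le]
    split_ifs <;> simp
  · simp [inner_basisVec_Lf]
  · simp [vac, inner_basisVec]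

theorem inner_F_apply (u : UMat n m) (j : Fin m) (X : Alg u) (x : Fock n m) :
    (inner ℂ (basisVec ([], [j])) (X.1 x) : ℂ) = chr u 0 X * inner ℂ (basisVec ([], [j])) x +
      inner ℂ (basisVec ([], [j])) (X.1 (vac n m)) * inner ℂ (vac n m) x := by
  refine inner_degree_one_apply u _ (fun k x => ?_) (fun j' x => ?_) ?_ X x
  · simp [inner_basisVec_nil_Le]
  · rw [basisVec_singleton_F u, inner_Lf_Lf, inner_Lf_Lf]
    split_ifs <;> simp
  · simp [vac, inner_basisVec]

theorem linPart_genE (u : UMat n m) (i : Fin n) (p : Pt n m) :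
    linPart u (genE u i) p = p.1 i := by
  simp [linPart_apply, genE, ← basisVec_singleton_E, inner_basisVec]

theorem linPart_genF (u : UMat n m) (j : Fin m) (p : Pt n m) :
    linPart u (genF u j) p = p.2 j := by
  simp [linPart_apply, genF, ← basisVec_singleton_F, inner_basisVec]

/-- `X ↦ linPart u X p` is a continuous point derivation at the vacuum character with values `p.1 i`
and `p.2 j` on the generators, which determine the derivative along `s ↦ s • p`. -/
theorem hasDerivAt_chr {u : UMat n m} {p : Pt n m} (hp : p ∈ Omega u) (X : Alg u) :
    HasDerivAt (fun s : ℂ => chr u (s • p) X) (linPart u X p) 0 := by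
  have hm : ∀ σ ∈ ball (0 : ℂ) 1, σ • p ∈ Omega u := fun σ hσ =>
    (circled_Omega u).smul_mem_of_norm_le_one hp (mem_ball_zero_iff.1 hσ).le
      (mem_ball_zero_iff.1 hσ).le
  have hev : ∀ᶠ σ in 𝓝 (0 : ℂ), σ ∈ ball (0 : ℂ) 1 := ball_mem_nhds _ one_pos
  refine (isCharFamily_chr hm).hasDerivAt isOpen_ball (by simp) (fun X => ?_)
    (fun X => linPart u X p) ?_ ?_ ?_ ?_ ?_ ?_ X
  · exact sliceHolo_chr hp X _ isOpen_ball id id differentiableOn_id differentiableOn_id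
      fun _ hσ => ⟨mem_ball_zero_iff.1 hσ, mem_ball_zero_iff.1 hσ⟩
  · simp only [linPart_apply]
    fun_prop
  · intro r
    simp [linPart_apply, Algebra.algebraMap_eq_smul_one, vac, inner_basisVec]
  · intro X Y
    have e : ∀ x, (X + Y).1 x = X.1 x + Y.1 x := fun x => rfl
    simp only [linPart_apply, e, inner_add_right, mul_add, Finset.sum_add_distrib]
    ring
  · intro X Y
    have e : ∀ x, (X * Y).1 x = X.1 (Y.1 x) := fun x => rfl
    have h1 : ∀ i, (inner ℂ (basisVec ([i], [])) ((X * Y).1 (vac n m)) : ℂ) =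
        inner ℂ (basisVec ([i], [])) (X.1 (vac n m)) * chr u 0 Y +
        chr u 0 X * inner ℂ (basisVec ([i], [])) (Y.1 (vac n m)) := fun i => by
      rw [e, inner_E_apply, inner_vac_apply, inner_vac_vac]
      ring
    have h2 : ∀ i, (inner ℂ (basisVec ([], [i])) ((X * Y).1 (vac n m)) : ℂ) =
        inner ℂ (basisVec ([], [i])) (X.1 (vac n m)) * chr u 0 Y +
        chr u 0 X * inner ℂ (basisVec ([], [i])) (Y.1 (vac n m)) := fun i => by
      rw [e, inner_F_apply, inner_vac_apply, inner_vac_vac]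
      ring
    simp only [linPart_apply, h1, h2, zero_smul, mul_add, Finset.sum_add_distrib, add_mul,
      Finset.sum_mul, Finset.mul_sum]
    simp only [mul_assoc, mul_left_comm (chr u 0 X)]
    ring
  · intro i
    rw [linPart_genE]
    have : HasDerivAt (fun σ : ℂ => σ * p.1 i) (p.1 i) 0 := by
      simpa using (hasDerivAt_id (0 : ℂ)).mul_const (p.1 i)
    exact this.congr_of_eventuallyEq (hev.mono fun σ hσ => chr_genE (hm σ hσ) i)
  · intro i
    rw [linPart_genF]
    have : HasDerivAt (fun σ : ℂ => σ * p.2 i) (p.2 i) 0 := by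
      simpa using (hasDerivAt_id (0 : ℂ)).mul_const (p.2 i)
    exact this.congr_of_eventuallyEq (hev.mono fun σ hσ => chr_genF (hm σ hσ) i)

/-! ### The induced map on points is biholomorphic. -/

/-- A point of `ℂⁿ × ℂᵐ` from its coordinates, as a continuous linear map. -/
def mkPt (n m : ℕ) : ((Fin n → ℂ) × (Fin m → ℂ)) →L[ℂ] Pt n m :=
  ((PiLp.continuousLinearEquiv 2 ℂ fun _ : Fin n => ℂ).symm.toContinuousLinearMap).prodMap
    ((PiLp.continuousLinearEquiv 2 ℂ fun _ : Fin m => ℂ).symm.toContinuousLinearMap)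

variable {u : UMat n m} {v : UMat n' m'}

/-- The map `θ_Ψ` on points. -/
def theta (Ψ : Alg u ≃ₐ[ℂ] Alg v) (p : Pt n m) : Pt n' m' :=
  mkPt n' m' (fun i => chr u p (Ψ.symm (genE v i)), fun j => chr u p (Ψ.symm (genF v j)))

/-- The derivative of `θ_Ψ` at the origin. -/
def thetaDeriv (Ψ : Alg u ≃ₐ[ℂ] Alg v) : Pt n m →ₗ[ℂ] Pt n' m' :=
  (mkPt n' m').toLinearMap ∘ₗ
    (LinearMap.pi fun i => linPart u (Ψ.symm (genE v i))).prod
      (LinearMap.pi fun j => linPart u (Ψ.symm (genF v j)))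

theorem theta_charPoint (Ψ : Alg u ≃ₐ[ℂ] Alg v) (φ : Alg u →ₐ[ℂ] ℂ) :
    theta Ψ (charPoint u φ) = charPoint v (φ.comp Ψ.symm.toAlgHom) := by
  rw [theta, chr_charPoint]
  rfl

theorem thetaEq_theta (Ψ : Alg u ≃ₐ[ℂ] Alg v) {p : Pt n m} (hp : p ∈ Omega u) :
    ThetaEq Ψ p (theta Ψ p) := by
  obtain ⟨φ, rfl⟩ := exists_char hp
  exact ⟨φ, rfl, (theta_charPoint Ψ φ).symm⟩

theorem holo_theta (Ψ : Alg u ≃ₐ[ℂ] Alg v) (h0 : theta Ψ 0 = 0) :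
    CircledHolo.Holo (Omega u) (Omega v) (theta Ψ) (thetaDeriv Ψ) where
  mem p hp := by
    obtain ⟨φ, rfl⟩ := exists_char hp
    rw [theta_charPoint]
    exact charPoint_mem_Omega v _
  zero := h0
  slice p hp U hU g₁ g₂ h₁ h₂ h := by
    refine (mkPt n' m').differentiable.comp_differentiableOn ?_
    refine DifferentiableOn.prodMk ?_ ?_ <;> refine differentiableOn_pi.2 fun i => ?_
    · exact sliceHolo_chr hp _ U hU g₁ g₂ h₁ h₂ h
    · exact sliceHolo_chr hp _ U hU g₁ g₂ h₁ h₂ h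
  deriv p hp := by
    refine (mkPt n' m').hasFDerivAt.comp_hasDerivAt 0 (HasDerivAt.prodMk ?_ ?_) <;>
      refine hasDerivAt_pi.2 fun i => ?_
    · exact hasDerivAt_chr hp _
    · exact hasDerivAt_chr hp _
  tendsto p hp := by
    refine ((mkPt n' m').continuous.tendsto _).comp (Tendsto.prodMk_nhds ?_ ?_) <;>
      refine tendsto_pi_nhds.2 fun i => ?_
    · exact tendsto_chr hp _
    · exact tendsto_chr hp _

theorem theta_symm_theta (Ψ : Alg u ≃ₐ[ℂ] Alg v) {p : Pt n m} (hp : p ∈ Omega u) :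
    theta Ψ.symm (theta Ψ p) = p := by
  obtain ⟨φ, rfl⟩ := exists_char hp
  rw [theta_charPoint, theta_charPoint]
  congr 1
  ext X
  change φ (Ψ.symm (Ψ.symm.symm X)) = φ X
  simp

theorem biholo_theta (Ψ : Alg u ≃ₐ[ℂ] Alg v) (h0 : ThetaEq Ψ (0, 0) (0, 0)) :
    CircledHolo.Biholo (Omega u) (Omega v) (theta Ψ) (theta Ψ.symm) (thetaDeriv Ψ)
      (thetaDeriv Ψ.symm) := by
  have hm : (0 : Pt n m) ∈ Omega u := (circled_Omega u).left_mem 0 (by simp)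
  have h1 : theta Ψ 0 = 0 := by
    obtain ⟨φ, h2, h3⟩ := h0
    rw [← theta_charPoint, h2] at h3
    exact h3
  have h2 : theta Ψ.symm 0 = 0 := by
    have := theta_symm_theta Ψ hm
    rwa [h1] at this
  refine ⟨circled_Omega u, circled_Omega v, holo_theta Ψ h1, holo_theta Ψ.symm h2,
    fun p hp => theta_symm_theta Ψ hp, fun p hp => ?_⟩
  simpa using theta_symm_theta Ψ.symm hp

/-! ### The vacuum is a separating vector. -/

/-- The vectors `f_β ⊗ e_α` are orthonormal. -/
theorem inner_FE_vac (u : UMat n m) (b b' : List (Fin m)) (a a' : List (Fin n)) :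
    (inner ℂ (((b.map (genF u)).prod * (a.map (genE u)).prod).1 (vac n m))
      (((b'.map (genF u)).prod * (a'.map (genE u)).prod).1 (vac n m)) : ℂ) =
      if b = b' ∧ a = a' then 1 else 0 := by
  have hmul : ∀ (X Y : Alg u) x, (X * Y).1 x = X.1 (Y.1 x) := fun _ _ _ => rfl
  have hE : ∀ a : List (Fin n), ((a.map (genE u)).prod).1 (vac n m) = basisVec (a, []) := by
    intro a
    induction a with
    | nil => rfl
    | cons i a ih =>
      rw [List.map_cons, List.prod_cons, hmul, ih]
      exact Le_basisVec i a []
  have hcons : ∀ j (b : List (Fin m)) (Y : Alg u) x, (((j :: b).map (genF u)).prod * Y).1 x =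
      Lf u j (((b.map (genF u)).prod * Y).1 x) := fun j b Y x => by
    rw [List.map_cons, List.prod_cons, mul_assoc, hmul]
    rfl
  induction b generalizing b' with
  | nil =>
    cases b' with
    | nil =>
      simp only [List.map_nil, List.prod_nil, one_mul, hE, inner_basisVec]
      simp
    | cons j' b' =>
      rw [hcons, List.map_nil, List.prod_nil, one_mul, hE, inner_basisVec_Lf]
      simp
  | cons j b ih =>
    cases b' with
    | nil =>
      rw [hcons, List.map_nil, List.prod_nil, one_mul, hE, ← inner_conj_symm, inner_basisVec_Lf]
      simp
    | cons j' b' =>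
      rw [hcons, hcons, inner_Lf_Lf, ih]
      by_cases h1 : j = j' <;> simp [h1]

theorem EF_vac (u : UMat n m) (a : List (Fin n)) (b : List (Fin m)) :
    ((a.map (genE u)).prod * (b.map (genF u)).prod).1 (vac n m) = basisVec (a, b) := by
  have hmul : ∀ (X Y : Alg u) x, (X * Y).1 x = X.1 (Y.1 x) := fun _ _ _ => rfl
  have hF : ∀ b : List (Fin m), ((b.map (genF u)).prod).1 (vac n m) = basisVec ([], b) := by
    intro b
    induction b with
    | nil => rfl
    | cons j b ih =>
      rw [List.map_cons, List.prod_cons, hmul, ih]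
      exact Lf_basisVec u j [] b
  rw [hmul, hF]
  induction a with
  | nil => rfl
  | cons i a ih =>
    rw [List.map_cons, List.prod_cons, hmul, ih]
    exact Le_basisVec i a b

/-- A vector orthogonal to all `X Ω`, `X` a monomial `L_{f_β} L_{e_α}`, vanishes. -/
theorem eq_zero_of_inner_FE (u : UMat n m) {y : Fock n m}
    (h : ∀ (b : List (Fin m)) (a : List (Fin n)),
      (inner ℂ (((b.map (genF u)).prod * (a.map (genE u)).prod).1 (vac n m)) y : ℂ) = 0) :
    y = 0 := by
  have key : ∀ X : Alg u, (inner ℂ (X.1 (vac n m)) y : ℂ) = 0 := by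
    intro X
    induction X using Alg.induction_FE with
    | hc => exact isClosed_eq (by fun_prop) continuous_const
    | hm b a => exact h b a
    | h0 => exact inner_zero_left _
    | hadd X Y hX hY =>
      have e : ∀ x, (X + Y).1 x = X.1 x + Y.1 x := fun x => rfl
      rw [e, inner_add_left, hX, hY, add_zero]
    | hsmul c X hX =>
      have e : ∀ x, (c • X).1 x = c • X.1 x := fun x => rfl
      rw [e, inner_smul_left, hX, mul_zero]
  have : innerSL ℂ y = 0 := clm_ext_basisVec fun ⟨a, b⟩ => by
    rw [innerSL_apply_apply, ← EF_vac u, ← inner_conj_symm, key]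
    simp
  have := congrArg (fun T => T y) this
  simpa using this

/-- Applying `X` to `e_i` acts on the vacuum vector of `X` like a right creation operator. In the
family `f_β ⊗ e_α` this merely appends the letter `i` to `α`, so the coefficients of `X e_i` are
those of `X` on the vacuum, shifted. -/
theorem apply_Le_vac_eq_zero {u : UMat n m} {X : Alg u} (hX : X.1 (vac n m) = 0) (i : Fin n) :
    X.1 (Le i (vac n m)) = 0 := by
  have hmul : ∀ (X Y : Alg u) x, (X * Y).1 x = X.1 (Y.1 x) := fun _ _ _ => rfl
  refine eq_zero_of_inner_FE u fun b a => ?_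
  have key : ∀ X : Alg u,
      (inner ℂ (((b.map (genF u)).prod * (a.map (genE u)).prod).1 (vac n m))
        (X.1 (Le i (vac n m))) : ℂ) =
      if a.getLast? = some i then
        inner ℂ (((b.map (genF u)).prod * (a.dropLast.map (genE u)).prod).1 (vac n m))
          (X.1 (vac n m)) else 0 := by
    intro X
    induction X using Alg.induction_FE with
    | hc => split_ifs <;> exact isClosed_eq (by fun_prop) (by fun_prop)
    | hm b' a' =>
      have e : (((b'.map (genF u)).prod * (a'.map (genE u)).prod).1 (Le i (vac n m))) =
          (((b'.map (genF u)).prod * ((a' ++ [i]).map (genE u)).prod).1 (vac n m)) := by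
        rw [List.map_append, List.prod_append, ← mul_assoc, hmul]
        simp [genE]
      rw [e, inner_FE_vac, inner_FE_vac]
      rcases List.eq_nil_or_concat a with rfl | ⟨a, k, rfl⟩
      · simp
      · by_cases hk : k = i <;> by_cases hb : b = b' <;> by_cases ha : a = a' <;>
          simp [hk, hb, ha]
    | h0 => simp
    | hadd X Y hX hY =>
      have e : ∀ x, (X + Y).1 x = X.1 x + Y.1 x := fun x => rfl
      rw [e, e, inner_add_right, inner_add_right, hX, hY]
      split_ifs <;> simp
    | hsmul c X hX =>
      have e : ∀ x, (c • X).1 x = c • X.1 x := fun x => rfl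
      rw [e, e, inner_smul_right, inner_smul_right, hX]
      split_ifs <;> simp
  rw [key, hX]
  simp

/-- The same shift in the order `e_α ⊗ f_β`, where `f_j` is appended to `β` without using the
relation. -/
theorem apply_Lf_vac_eq_zero {u : UMat n m} {X : Alg u} (hX : X.1 (vac n m) = 0) (j : Fin m) :
    X.1 (Lf u j (vac n m)) = 0 := by
  have hmul : ∀ (X Y : Alg u) x, (X * Y).1 x = X.1 (Y.1 x) := fun _ _ _ => rfl
  have key : ∀ (a : List (Fin n)) (b : List (Fin m)) (X : Alg u),
      (inner ℂ (basisVec (a, b)) (X.1 (Lf u j (vac n m))) : ℂ) =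
      if b.getLast? = some j then inner ℂ (basisVec (a, b.dropLast)) (X.1 (vac n m)) else 0 := by
    intro a b X
    induction X using Alg.induction_EF with
    | hc => split_ifs <;> exact isClosed_eq (by fun_prop) (by fun_prop)
    | hm a' b' =>
      have e : (((a'.map (genE u)).prod * (b'.map (genF u)).prod).1 (Lf u j (vac n m))) =
          (((a'.map (genE u)).prod * ((b' ++ [j]).map (genF u)).prod).1 (vac n m)) := by
        rw [List.map_append, List.prod_append, ← mul_assoc, hmul]
        simp [genF]
      rw [e, EF_vac, EF_vac, inner_basisVec, inner_basisVec]
      rcases List.eq_nil_or_concat b with rfl | ⟨b, k, rfl⟩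
      · simp
      · by_cases hk : k = j <;> by_cases hb : b = b' <;> by_cases ha : a = a' <;>
          simp [hk, hb, ha]
    | h0 => simp
    | hadd X Y hX hY =>
      have e : ∀ x, (X + Y).1 x = X.1 x + Y.1 x := fun x => rfl
      rw [e, e, inner_add_right, inner_add_right, hX, hY]
      split_ifs <;> simp
    | hsmul c X hX =>
      have e : ∀ x, (c • X).1 x = c • X.1 x := fun x => rfl
      rw [e, e, inner_smul_right, inner_smul_right, hX]
      split_ifs <;> simp
  have : innerSL ℂ (X.1 (Lf u j (vac n m))) = 0 := clm_ext_basisVec fun ⟨a, b⟩ => by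
    rw [innerSL_apply_apply, ← inner_conj_symm, key, hX]
    simp
  have := congrArg (fun T => T (X.1 (Lf u j (vac n m)))) this
  simpa using this

/-- The vacuum vector is separating for `𝒜_u`. -/
theorem eq_zero_of_apply_vac {u : UMat n m} {X : Alg u} (hX : X.1 (vac n m) = 0) : X = 0 := by
  have hmul : ∀ (X Y : Alg u) x, (X * Y).1 x = X.1 (Y.1 x) := fun _ _ _ => rfl
  have h2 : ∀ (b : List (Fin m)) (X : Alg u), X.1 (vac n m) = 0 →
      (X * (b.map (genF u)).prod).1 (vac n m) = 0 := by
    intro b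
    induction b with
    | nil => intro X hX; simpa using hX
    | cons j b ih =>
      intro X hX
      rw [List.map_cons, List.prod_cons, ← mul_assoc]
      exact ih (X * genF u j) (apply_Lf_vac_eq_zero hX j)
  have h1 : ∀ (a : List (Fin n)) (b : List (Fin m)) (X : Alg u), X.1 (vac n m) = 0 →
      (X * ((a.map (genE u)).prod * (b.map (genF u)).prod)).1 (vac n m) = 0 := by
    intro a b
    induction a with
    | nil => intro X hX; simpa using h2 b X hX
    | cons i a ih =>
      intro X hX
      rw [List.map_cons, List.prod_cons, mul_assoc, ← mul_assoc]
      exact ih (X * genE u i) (apply_Le_vac_eq_zero hX i)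
  refine Subtype.ext (clm_ext_basisVec fun ⟨a, b⟩ => ?_)
  rw [← EF_vac u a b, ← hmul, h1 a b X hX]
  rfl

/-- A contraction in `𝒜_u` whose vacuum coefficients with respect to an orthonormal family `T_j Ω`
are those of a unit vector is the corresponding combination of the `T_j`. -/
theorem eq_sum_of_inner_eq {ι : Type*} [Fintype ι] {T : ι → Alg u}
    (hT : Orthonormal ℂ fun j => (T j).1 (vac n m)) {Y : Alg u} (hY : ‖Y‖ ≤ 1) {c : ι → ℂ}
    (hc : ∑ j, conj (c j) * c j = 1) (h : ∀ j, inner ℂ ((T j).1 (vac n m)) (Y.1 (vac n m)) = c j) :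
    Y = ∑ j, c j • T j := by
  classical
  have hS : (∑ j, c j • T j : Alg u).1 (vac n m) = ∑ j, c j • (T j).1 (vac n m) := by
    simp
  have hn : ‖Y.1 (vac n m)‖ ≤ 1 := by
    have := Y.1.le_opNorm (vac n m)
    rw [norm_vac, mul_one] at this
    exact this.trans hY
  set η : Fock n m := ∑ j, c j • (T j).1 (vac n m) with hη
  have h1 : (inner ℂ η (Y.1 (vac n m)) : ℂ) = 1 := by
    rw [hη, sum_inner, ← hc]
    exact Finset.sum_congr rfl fun j _ => by rw [inner_smul_left, h]
  have h2 : (inner ℂ η η : ℂ) = 1 := by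
    rw [hη, hT.inner_sum, ← hc]
  have h3 : ‖η‖ ^ 2 = 1 := by
    rw [@norm_sq_eq_re_inner ℂ, h2]
    simp
  -- Expanding gives `1 - 2 + ‖Y.1 (vac n m)‖ ^ 2`, which is at most 0: the equality case of
  -- Cauchy–Schwarz.
  have h4 : ‖η - Y.1 (vac n m)‖ ^ 2 = 0 := by
    refine le_antisymm ?_ (by positivity)
    rw [@norm_sub_sq ℂ, h1, h3]
    simp only [RCLike.one_re]
    nlinarith [norm_nonneg (Y.1 (vac n m))]
  have h5 : η - Y.1 (vac n m) = 0 := by simpa using h4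
  refine sub_eq_zero.1 (eq_zero_of_apply_vac ?_)
  change Y.1 (vac n m) - (∑ j, c j • T j : Alg u).1 (vac n m) = 0
  rw [hS, ← neg_sub, h5, neg_zero]

theorem orthonormal_genE_vac (u : UMat n m) :
    Orthonormal ℂ fun i => (genE u i).1 (vac n m) := by
  rw [orthonormal_iff_ite]
  intro i j
  change (inner ℂ (Le i (vac n m)) (Le j (vac n m)) : ℂ) = _
  rw [inner_Le_Le, inner_vac_vac]

theorem orthonormal_genF_vac (u : UMat n m) :
    Orthonormal ℂ fun i => (genF u i).1 (vac n m) := by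
  rw [orthonormal_iff_ite]
  intro i j
  change (inner ℂ (Lf u i (vac n m)) (Lf u j (vac n m)) : ℂ) = _
  rw [inner_Lf_Lf, inner_vac_vac]

theorem inner_genE_vac (X : Alg u) (i : Fin n) :
    inner ℂ ((genE u i).1 (vac n m)) (X.1 (vac n m)) =
      linPart u X (EuclideanSpace.single i 1, 0) := by
  rw [linPart_apply]
  simp [basisVec_singleton_E, genE]

theorem inner_genF_vac (X : Alg u) (j : Fin m) :
    inner ℂ ((genF u j).1 (vac n m)) (X.1 (vac n m)) =
      linPart u X (0, EuclideanSpace.single j 1) := by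
  rw [linPart_apply]
  simp [basisVec_singleton_F u, genF]

/-! ### Isometric isomorphisms. -/

theorem chr_theta_apply (Ψ : Alg u ≃ₐ[ℂ] Alg v) {p : Pt n m} (hp : p ∈ Omega u) (X : Alg u) :
    chr v (theta Ψ p) (Ψ X) = chr u p X := by
  obtain ⟨φ, rfl⟩ := exists_char hp
  rw [theta_charPoint, chr_charPoint, chr_charPoint]
  change φ (Ψ.symm (Ψ X)) = φ X
  rw [AlgEquiv.symm_apply_apply]

/-- Differentiating `chr_theta_apply` at `s = 0` along the disc through `p`. -/
theorem linPart_map (Ψ : Alg u ≃ₐ[ℂ] Alg v) {p : Pt n m} {q : Pt n' m'} (hp : p ∈ Omega u)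
    (hq : q ∈ Omega v) (h : ∀ s : ℂ, ‖s‖ < 1 → theta Ψ (s • p) = s • q) (X : Alg u) :
    linPart v (Ψ X) q = linPart u X p := by
  refine (hasDerivAt_chr hq (Ψ X)).unique ((hasDerivAt_chr hp X).congr_of_eventuallyEq ?_)
  filter_upwards [ball_mem_nhds (0 : ℂ) one_pos] with s hs
  have hs := mem_ball_zero_iff.1 hs
  rw [← h s hs]
  exact chr_theta_apply Ψ ((circled_Omega u).smul_mem_of_norm_le_one hp hs.le hs.le) X

/-- The matrix of `U⁻¹`, for an isometry `U`. -/
def isometryMatrix {k l : ℕ} (U : EuclideanSpace ℂ (Fin k) ≃ₗᵢ[ℂ] EuclideanSpace ℂ (Fin l)) :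
    Matrix (Fin k) (Fin l) ℂ :=
  Matrix.of fun i j => U.symm (EuclideanSpace.single j 1) i

theorem isUnitaryMat_isometryMatrix {k l : ℕ}
    (U : EuclideanSpace ℂ (Fin k) ≃ₗᵢ[ℂ] EuclideanSpace ℂ (Fin l)) :
    IsUnitaryMat (isometryMatrix U) := by
  have h1 : ∀ i j, isometryMatrix U i j =
      inner ℂ (EuclideanSpace.single i 1) (U.symm (EuclideanSpace.single j 1)) := fun i j => by
    simp [isometryMatrix, EuclideanSpace.inner_single_left]
  have h2 : ∀ i j, isometryMatrix U i j = conj (U (EuclideanSpace.single i 1) j) := fun i j => by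
    rw [h1, ← U.inner_map_map, U.apply_symm_apply, EuclideanSpace.inner_single_right]
    simp
  constructor <;> ext i j
  · have := U.inner_map_map (EuclideanSpace.single i 1) (EuclideanSpace.single j 1)
    rw [EuclideanSpace.inner_single_left, PiLp.inner_apply] at this
    simp only [Matrix.mul_apply, Matrix.conjTranspose_apply, h2, Matrix.one_apply]
    simpa [mul_comm, eq_comm, Pi.single_apply] using this
  · have := U.symm.inner_map_map (EuclideanSpace.single i 1) (EuclideanSpace.single j 1)
    rw [EuclideanSpace.inner_single_left, PiLp.inner_apply] at this
    simp only [Matrix.mul_apply, Matrix.conjTranspose_apply, isometryMatrix, Matrix.of_apply,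
      Matrix.one_apply]
    simpa [mul_comm, eq_comm, Pi.single_apply] using this

theorem sum_conj_mul_isometryMatrix {k l : ℕ}
    (U : EuclideanSpace ℂ (Fin k) ≃ₗᵢ[ℂ] EuclideanSpace ℂ (Fin l)) (i : Fin k) :
    ∑ j, conj (isometryMatrix U i j) * isometryMatrix U i j = 1 := by
  have := congrFun (congrFun (isUnitaryMat_isometryMatrix U).1 i) i
  rw [Matrix.mul_apply, Matrix.one_apply_eq] at this
  rw [← this]
  exact Finset.sum_congr rfl fun j _ => by
    rw [Matrix.conjTranspose_apply, mul_comm]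
    rfl

theorem norm_genE_le_one (u : UMat n m) (i : Fin n) : ‖genE u i‖ ≤ 1 := by
  simpa using norm_sum_smul_genE_le u (EuclideanSpace.single i 1)

theorem norm_genF_le_one (u : UMat n m) (j : Fin m) : ‖genF u j‖ ≤ 1 := by
  simpa using norm_sum_smul_genF_le u (EuclideanSpace.single j 1)

section Single

variable {k l : ℕ} (U : EuclideanSpace ℂ (Fin k) ≃ₗᵢ[ℂ] EuclideanSpace ℂ (Fin l))

theorem norm_symm_single_le (j : Fin l) : ‖U.symm (EuclideanSpace.single j 1)‖ ≤ 1 := by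
  simp

theorem norm_single_le (j : Fin l) :
    ‖(EuclideanSpace.single j 1 : EuclideanSpace ℂ (Fin l))‖ ≤ 1 := by
  simp

end Single

/-- By `linPart_map`, the coefficient of `Ψ (genE u i)` at `e_j` is the `i`-th coordinate of `U⁻¹
e_j`. For fixed `i` these form a row of a unitary matrix, hence a unit vector, and
`eq_sum_of_inner_eq` applies. -/
theorem isBigraded_of_theta (Ψ : Alg u ≃ₐ[ℂ] Alg v) (hΨ : ∀ X, ‖Ψ X‖ = ‖X‖)
    (U : EuclideanSpace ℂ (Fin n) ≃ₗᵢ[ℂ] EuclideanSpace ℂ (Fin n'))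
    (V : EuclideanSpace ℂ (Fin m) ≃ₗᵢ[ℂ] EuclideanSpace ℂ (Fin m'))
    (h : ∀ p ∈ Omega u, theta Ψ p = (U p.1, V p.2)) : IsBigraded Ψ := by
  have hc := circled_Omega u
  have hc' := circled_Omega v
  refine ⟨isometryMatrix U, isometryMatrix V, isUnitaryMat_isometryMatrix U,
    isUnitaryMat_isometryMatrix V, fun i => ?_, fun i => ?_⟩
  · refine eq_sum_of_inner_eq (orthonormal_genE_vac v) ((hΨ _).le.trans (norm_genE_le_one u i))
      (sum_conj_mul_isometryMatrix U i) fun j => ?_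
    have hp := hc.left_mem _ (norm_symm_single_le U j)
    rw [inner_genE_vac, linPart_map Ψ hp (hc'.left_mem _ (norm_single_le j)) ?_, linPart_genE]
    · rfl
    · intro s hs
      refine (h _ (hc.smul_mem_of_norm_le_one hp hs.le hs.le)).trans ?_
      simp
  · refine eq_sum_of_inner_eq (orthonormal_genF_vac v) ((hΨ _).le.trans (norm_genF_le_one u i))
      (sum_conj_mul_isometryMatrix V i) fun j => ?_
    have hp := hc.right_mem _ (norm_symm_single_le V j)
    rw [inner_genF_vac, linPart_map Ψ hp (hc'.right_mem _ (norm_single_le j)) ?_, linPart_genF]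
    · rfl
    · intro s hs
      refine (h _ (hc.smul_mem_of_norm_le_one hp hs.le hs.le)).trans ?_
      simp

theorem exists_exchange_of_theta (Ψ : Alg u ≃ₐ[ℂ] Alg v) (hΨ : ∀ X, ‖Ψ X‖ = ‖X‖)
    (U : EuclideanSpace ℂ (Fin n) ≃ₗᵢ[ℂ] EuclideanSpace ℂ (Fin m'))
    (V : EuclideanSpace ℂ (Fin m) ≃ₗᵢ[ℂ] EuclideanSpace ℂ (Fin n'))
    (h : ∀ p ∈ Omega u, theta Ψ p = (V p.2, U p.1)) :
    (∀ i, Ψ (genE u i) = ∑ j, isometryMatrix U i j • genF v j) ∧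
      (∀ k, Ψ (genF u k) = ∑ l, isometryMatrix V k l • genE v l) := by
  have hc := circled_Omega u
  have hc' := circled_Omega v
  refine ⟨fun i => ?_, fun i => ?_⟩
  · refine eq_sum_of_inner_eq (orthonormal_genF_vac v) ((hΨ _).le.trans (norm_genE_le_one u i))
      (sum_conj_mul_isometryMatrix U i) fun j => ?_
    have hp := hc.left_mem _ (norm_symm_single_le U j)
    rw [inner_genF_vac, linPart_map Ψ hp (hc'.right_mem _ (norm_single_le j)) ?_, linPart_genE]
    · rfl
    · intro s hs
      refine (h _ (hc.smul_mem_of_norm_le_one hp hs.le hs.le)).trans ?_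
      simp
  · refine eq_sum_of_inner_eq (orthonormal_genE_vac v) ((hΨ _).le.trans (norm_genF_le_one u i))
      (sum_conj_mul_isometryMatrix V i) fun j => ?_
    have hp := hc.right_mem _ (norm_symm_single_le V j)
    rw [inner_genE_vac, linPart_map Ψ hp (hc'.left_mem _ (norm_single_le j)) ?_, linPart_genF]
    · rfl
    · intro s hs
      refine (h _ (hc.smul_mem_of_norm_le_one hp hs.le hs.le)).trans ?_
      simp

/-- An exchange turns `L_{e_α} L_{f_β}` into combinations of products with the `F`-letters in front;
the homogeneous relations restore the order and keep the total degree. -/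
theorem map_mem_gradedPart (Ψ : Alg u ≃ₐ[ℂ] Alg v) {A : Matrix (Fin n) (Fin m') ℂ}
    {B : Matrix (Fin m) (Fin n') ℂ} (hA : ∀ i, Ψ (genE u i) = ∑ j, A i j • genF v j)
    (hB : ∀ k, Ψ (genF u k) = ∑ l, B k l • genE v l) {N : ℕ} {X : Alg u}
    (hX : X ∈ gradedPart u N) : Ψ X ∈ gradedPart v N := by
  have hF : ∀ (i : Fin n) {N : ℕ} {Y : Alg v}, Y ∈ gradedPart v N →
      Ψ (genE u i) * Y ∈ gradedPart v (N + 1) := by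
    intro i N Y hY
    rw [hA, Finset.sum_mul]
    refine Submodule.sum_mem _ fun j _ => ?_
    rw [smul_mul_assoc]
    exact Submodule.smul_mem _ _ (mul_monomialSpan_right (c := fun q p => conj (v.1 p q))
      (fun i j => genF_mul_genE v j i) j hY)
  have hE : ∀ (k : Fin m) {N : ℕ} {Y : Alg v}, Y ∈ gradedPart v N →
      Ψ (genF u k) * Y ∈ gradedPart v (N + 1) := by
    intro k N Y hY
    rw [hB, Finset.sum_mul]
    refine Submodule.sum_mem _ fun j _ => ?_
    rw [smul_mul_assoc]
    exact Submodule.smul_mem _ _ (mul_monomialSpan_left j hY)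
  induction hX using Submodule.span_induction with
  | mem X hX =>
    obtain ⟨a, b, rfl, rfl⟩ := hX
    induction a with
    | nil =>
      rw [List.map_nil, List.prod_nil, one_mul, List.length_nil, zero_add]
      induction b with
      | nil =>
        rw [List.map_nil, List.prod_nil, map_one]
        exact Submodule.subset_span ⟨[], [], rfl, by simp⟩
      | cons k b ih =>
        rw [List.map_cons, List.prod_cons, map_mul, List.length_cons]
        exact hE k ih
    | cons i a ih =>
      rw [List.map_cons, List.prod_cons, mul_assoc, map_mul, List.length_cons, add_right_comm]
      exact hF i ih
  | zero => simp
  | add X Y _ _ h1 h2 => rw [map_add]; exact add_mem h1 h2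
  | smul c X _ h => rw [map_smul]; exact Submodule.smul_mem _ _ h

theorem symm_apply_eq_sum (Ψ : Alg u ≃ₐ[ℂ] Alg v) {k l : ℕ} {A : Matrix (Fin k) (Fin l) ℂ}
    (hA : IsUnitaryMat A) {x : Fin k → Alg u} {y : Fin l → Alg v}
    (h : ∀ i, Ψ (x i) = ∑ j, A i j • y j) (j : Fin l) :
    Ψ.symm (y j) = ∑ i, A.conjTranspose j i • x i := by
  rw [AlgEquiv.symm_apply_eq, map_sum]
  have h1 : ∀ j', ∑ i, A.conjTranspose j i * A i j' = if j = j' then 1 else 0 := fun j' => by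
    rw [← Matrix.mul_apply, hA.2, Matrix.one_apply]
  simp only [map_smul, h, Finset.smul_sum, smul_smul]
  rw [Finset.sum_comm]
  simp only [← Finset.sum_smul, h1]
  simp

theorem isGradedExchange_of_theta (Ψ : Alg u ≃ₐ[ℂ] Alg v) (hΨ : ∀ X, ‖Ψ X‖ = ‖X‖)
    (U : EuclideanSpace ℂ (Fin n) ≃ₗᵢ[ℂ] EuclideanSpace ℂ (Fin m'))
    (V : EuclideanSpace ℂ (Fin m) ≃ₗᵢ[ℂ] EuclideanSpace ℂ (Fin n'))
    (h : ∀ p ∈ Omega u, theta Ψ p = (V p.2, U p.1)) : IsGradedExchange Ψ := by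
  obtain ⟨hA, hB⟩ := exists_exchange_of_theta Ψ hΨ U V h
  have hU := isUnitaryMat_isometryMatrix U
  have hV := isUnitaryMat_isometryMatrix V
  refine ⟨fun N => le_antisymm ?_ ?_, isometryMatrix U, isometryMatrix V, hU, hV, hA, hB⟩
  · rintro _ ⟨X, hX, rfl⟩
    exact map_mem_gradedPart Ψ hA hB hX
  -- `Ψ.symm` is again an exchange, with the adjoint matrices, so the same inclusion applies to it.
  · intro Y hY
    exact ⟨Ψ.symm Y, map_mem_gradedPart Ψ.symm (symm_apply_eq_sum Ψ hV hB)
      (symm_apply_eq_sum Ψ hU hA) hY, Ψ.apply_symm_apply Y⟩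

theorem eq_of_isometryEquiv {k l : ℕ}
    (U : EuclideanSpace ℂ (Fin k) ≃ₗᵢ[ℂ] EuclideanSpace ℂ (Fin l)) : k = l := by
  simpa using U.toLinearEquiv.finrank_eq

end UnitaryRelation

end

open UnitaryRelation
theorem proposition5p7 {n m n' m' : ℕ} (u : UMat n m) (v : UMat n' m')
    (Ψ : Alg u ≃ₐ[ℂ] Alg v) (h0 : ThetaEq Ψ (0, 0) (0, 0)) :
    ({n, m} : Set ℕ) = {n', m'} ∧
    ((n = n' ∧ m = m' ∧
        ∃ (U : EuclideanSpace ℂ (Fin n) ≃ₗᵢ[ℂ] EuclideanSpace ℂ (Fin n'))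
          (V : EuclideanSpace ℂ (Fin m) ≃ₗᵢ[ℂ] EuclideanSpace ℂ (Fin m')),
          ∀ p ∈ Omega u, ThetaEq Ψ p (U p.1, V p.2)) ∨
      (n = m' ∧ m = n' ∧
        ∃ (U : EuclideanSpace ℂ (Fin n) ≃ₗᵢ[ℂ] EuclideanSpace ℂ (Fin m'))
          (V : EuclideanSpace ℂ (Fin m) ≃ₗᵢ[ℂ] EuclideanSpace ℂ (Fin n')),
          ∀ p ∈ Omega u, ThetaEq Ψ p (V p.2, U p.1))) ∧
    ((∀ X : Alg u, ‖Ψ X‖ = ‖X‖) → IsBigraded Ψ ∨ IsGradedExchange Ψ) := by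
  rcases (biholo_theta Ψ h0).exists_isometries with ⟨U, V, h⟩ | ⟨U, V, h⟩
  · have h1 := eq_of_isometryEquiv U
    have h2 := eq_of_isometryEquiv V
    refine ⟨by rw [h1, h2], Or.inl ⟨h1, h2, U, V, fun p hp => ?_⟩,
      fun hΨ => Or.inl (isBigraded_of_theta Ψ hΨ U V h)⟩
    rw [← h p hp]
    exact thetaEq_theta Ψ hp
  · have h1 := eq_of_isometryEquiv U
    have h2 := eq_of_isometryEquiv V
    refine ⟨by rw [h1, h2, Set.pair_comm], Or.inr ⟨h1, h2, U, V, fun p hp => ?_⟩,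
      fun hΨ => Or.inr (isGradedExchange_of_theta Ψ hΨ U V h)⟩
    rw [← h p hp]
    exact thetaEq_theta Ψ hp
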